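/- **Setting.** Write $[A]$ for the convex hull of $A$, and $[P,z]=[P\cup\{z\}]$ for a polytope $P$ and a point $z$. A $d$-polytope in $\mathbb E^d$ is the convex hull of a finite set that affinely spans $\mathbb E^d$; its faces are $\emptyset$, itself, and its intersections with supporting hyperplanes; $\mathcal V(P)$ is its set of vertices. Let $m>1$ and let $P\subset\mathbb E^{2m}$ be a neighbourly $2m$-polytope (the convex hull of any $m$ vertices is a proper face) with at least $2m+3$ vertices. A $k$-face $U$ of $P$, $k$ odd, is *universal* if $[S\cup U]$ is a face of $P$ for every $S\subseteq\mathcal V(P)$ with $|S|\le\lfloor(2m-k-1)/2\rfloor$. Let $x_1,\dots,x_m,y_1,\dots,y_m$ be distinct vertices of $P$, put $\Phi_0=\emptyset$ and $\Phi_j=[\Phi_{j-1}\cup\{x_j,y_j\}]$, and assume that $\Phi_j$ is a universal $(2j-1)$-face of $P$ for $1\le j\le m$ (a universal tower). Given a full-dimensional polytope $R$ and an increasing chain $\Psi_1\subset\dots\subset\Psi_r$ of faces of $R$ ($r\ge 0$), let $\mathscr F_0$ be the set of all facets of $R$ (a point has none), let $\mathscr F_j$ be the set of facets containing $\Psi_j$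 for $1\le j\le r$, let $\mathscr F_j=\emptyset$ for $j>r$, and let $\mathcal C=(\mathscr F_1\setminus\mathscr F_2)\cup(\mathscr F_3\setminus\mathscr F_4)\cup\cdots$. A point $z$ *lies exactly beyond the chain* if $\operatorname{aff}F$ strictly separates $z$ from $R$ for every $F\in\mathcal C$, while $z$ lies strictly on the same side of $\operatorname{aff}F$ as $R$ for every other facet $F$. Then $[R,z]$ is said to be obtained from $R$ by sewing $z$ through the chain. For a face $G$ of a polytope $R$, the quotient $R/G$ is a polytope whose face lattice is identified, by a fixed isomorphism, with the interval $[G,R]$ of the face lattice of $R$; a face $A\supseteq G$ of $R$ corresponds to a face of $R/G$. The vertex of $R/G$ corresponding to $v\in\mathcal V(R)\setminus\mathcal V(G)$ is the vertex (when there is one) that corresponds to the least face of $R$ containing $G$ and $v$. **Theorem 3.1.** Let $\bar x$ lie exactly beyond the chain $\Phi_1,\dots,\Phi_m$ of $P$, let $P^+=[P,\bar x]$, and let $1\le i\le m$. Then $\Phi_i$ is a face of $P$ and $[\Phi_{i-1}\cup\{x_i,\bar x\}]$ is a face of $P^+$. Let $P/\Phi_i$ and $P^+/[\Phi_{i-1}\cup\{x_i,\bar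 x\}]$ be any realizations in $\mathbb E^{2m-2i}$, as $(2m-2i)$-polytopes, of these quotients, and write $v^*$ and $v^{**}$ for the vertices corresponding to $v$ in the first and in the second. Let $\Phi_{i+1}^*,\dots,\Phi_m^*$ be the faces of $P/\Phi_i$ corresponding to $\Phi_{i+1},\dots,\Phi_m$, let $\bar y^*\in\mathbb E^{2m-2i}$ lie exactly beyond this chain, and let $(P/\Phi_i)^+=[P/\Phi_i,\bar y^*]$. Then $$(P/\Phi_i)^+\;\cong\;P^+/[\Phi_{i-1}\cup\{x_i,\bar x\}]$$ combinatorially. More precisely, for each $v\in\mathcal V(P)\setminus\mathcal V(\Phi_i)$ the vertices $v^*$ and $v^{**}$ exist, $y_i^{**}$ exists, the vertices of $(P/\Phi_i)^+$ are exactly these $v^*$ together with $\bar y^*$ (pairwise distinct if $i<m$; for $i=m$ both polytopes are single points), and there is an isomorphism of face lattices inducing the bijection of vertices $$v^*\mapsto v^{**}\quad(v\in\mathcal V(P)\setminus\mathcal V(\Phi_i)),\qquad \bar y^*\mapsto y_i^{**}.$$ -/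

import Mathlib

namespace Sewing

/-- Euclidean `d`-space. -/
abbrev Euc (d : ℕ) : Type := EuclideanSpace ℝ (Fin d)

/-- `P` is a `d`-dimensional convex polytope in Euclidean `d`-space: the convex hull of a finite
point set whose affine hull is the whole space. -/
def IsFullPolytope {d : ℕ} (P : Set (Euc d)) : Prop :=
  (∃ s : Finset (Euc d), P = convexHull ℝ (s : Set (Euc d))) ∧ affineSpan ℝ P = ⊤

/-- Faces: the empty face, `P` itself, and the intersections of `P` with supporting hyperplanes
(the functional `0` gives `P`). -/
def IsFace {d : ℕ} (P F : Set (Euc d)) : Prop := IsExposed ℝ P F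

/-- The faces of `P`, ordered by inclusion: the face lattice. -/
abbrev Face {d : ℕ} (P : Set (Euc d)) : Type := {F : Set (Euc d) // IsFace P F}

/-- The vertices: the points that form a `0`-dimensional face. -/
def vertices {d : ℕ} (P : Set (Euc d)) : Set (Euc d) := {v | IsFace P {v}}

/-- The dimension of the affine hull of a nonempty set. -/
noncomputable def dim {d : ℕ} (A : Set (Euc d)) : ℕ := Module.finrank ℝ (vectorSpan ℝ A)

/-- The facets: nonempty faces of codimension one. -/
def facets {d : ℕ} (P : Set (Euc d)) : Set (Set (Euc d)) :=
  {F | IsFace P F ∧ F.Nonempty ∧ dim F + 1 = dim P}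

/-- A `d`-polytope is neighbourly if every `⌊d/2⌋` of its vertices determine (have as their
convex hull) a proper face. -/
def IsNeighbourly {d : ℕ} (P : Set (Euc d)) : Prop :=
  ∀ S : Finset (Euc d), (S : Set (Euc d)) ⊆ vertices P → S.card = d / 2 →
    IsFace P (convexHull ℝ (S : Set (Euc d))) ∧ convexHull ℝ (S : Set (Euc d)) ≠ P

/-- `U` is a universal `k`-face of the `d`-polytope `P`: the convex hull of `U` with any
at most `⌊(d - k - 1)/2⌋` vertices of `P` is a face of `P`. -/
def IsUniversalFace {d : ℕ} (P : Set (Euc d)) (k : ℕ) (U : Set (Euc d)) : Prop :=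
  IsFace P U ∧ U.Nonempty ∧ dim U = k ∧
    ∀ S : Finset (Euc d), (S : Set (Euc d)) ⊆ vertices P → S.card ≤ (d - k - 1) / 2 →
      IsFace P (convexHull ℝ ((S : Set (Euc d)) ∪ U))

/-- `Φ_0 = ∅` and `Φ_j = [Φ_{j-1}, x_j, y_j]` for `j ≥ 1`. -/
def towerFace {d : ℕ} (x y : ℕ → Euc d) : ℕ → Set (Euc d)
  | 0 => ∅
  | j + 1 => convexHull ℝ (towerFace x y j ∪ {x (j + 1), y (j + 1)})

/-- `x_1, …, x_m, y_1, …, y_m` are distinct vertices of `P` and each `Φ_j`, `1 ≤ j ≤ m`, is a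
universal `(2j-1)`-face of `P`. Values of `x` and `y` at other indices play no role. -/
structure IsUniversalTower {d : ℕ} (P : Set (Euc d)) (m : ℕ) (x y : ℕ → Euc d) : Prop where
  x_mem : ∀ j ∈ Set.Icc 1 m, x j ∈ vertices P
  y_mem : ∀ j ∈ Set.Icc 1 m, y j ∈ vertices P
  x_inj : Set.InjOn x (Set.Icc 1 m)
  y_inj : Set.InjOn y (Set.Icc 1 m)
  x_ne_y : ∀ j ∈ Set.Icc 1 m, ∀ k ∈ Set.Icc 1 m, x j ≠ y k
  universal : ∀ j ∈ Set.Icc 1 m, IsUniversalFace P (2 * j - 1) (towerFace x y j)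

/-- For a chain `Φ_1, …, Φ_m`: the facets of `P` containing `Φ_j`, where `j = 0` gives all facets
and `j > m` gives none. -/
def towerFacets {d : ℕ} (P : Set (Euc d)) (m : ℕ) (Φ : ℕ → Set (Euc d)) (j : ℕ) :
    Set (Set (Euc d)) :=
  {F | F ∈ facets P ∧ j ≤ m ∧ (1 ≤ j → Φ j ⊆ F)}

/-- `(𝓕_1 \ 𝓕_2) ∪ (𝓕_3 \ 𝓕_4) ∪ …` -/
def beyondFacets {d : ℕ} (P : Set (Euc d)) (m : ℕ) (Φ : ℕ → Set (Euc d)) : Set (Set (Euc d)) :=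
  ⋃ k : ℕ, towerFacets P m Φ (2 * k + 1) \ towerFacets P m Φ (2 * k + 2)

/-- The hyperplane `aff F` strictly separates the point `z` from `P`. -/
def IsBeyond {d : ℕ} (P F : Set (Euc d)) (z : Euc d) : Prop :=
  ∃ (l : Euc d →ₗ[ℝ] ℝ) (c : ℝ), (∀ w, w ∈ affineSpan ℝ F ↔ l w = c) ∧ (∀ p ∈ P, l p ≤ c) ∧ c < l z

/-- The point `z` lies off the hyperplane `aff F`, strictly on the same side as `P`. -/
def IsBeneath {d : ℕ} (P F : Set (Euc d)) (z : Euc d) : Prop :=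
  ∃ (l : Euc d →ₗ[ℝ] ℝ) (c : ℝ), (∀ w, w ∈ affineSpan ℝ F ↔ l w = c) ∧ (∀ p ∈ P, l p ≤ c) ∧ l z < c

/-- `z` lies exactly beyond the set of facets determined by the chain `Φ_1, …, Φ_m`. -/
def IsExactlyBeyond {d : ℕ} (P : Set (Euc d)) (m : ℕ) (Φ : ℕ → Set (Euc d)) (z : Euc d) : Prop :=
  (∀ F ∈ beyondFacets P m Φ, IsBeyond P F z) ∧
    ∀ F ∈ facets P \ beyondFacets P m Φ, IsBeneath P F z

/-- `[P, z]`. -/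
def sewn {d : ℕ} (P : Set (Euc d)) (z : Euc d) : Set (Euc d) := convexHull ℝ (insert z P)

/-- A realization, as an `e`-polytope in Euclidean `e`-space, of the quotient polytope `P/G` of
`P` by its face `G`: a polytope together with an isomorphism of its face lattice onto the
interval `[G, P]` of the face lattice of `P`. -/
structure QuotientPolytope {d : ℕ} (P : Set (Euc d)) (G : Face P) (e : ℕ) where
  carrier : Set (Euc e)
  isFullPolytope : IsFullPolytope carrier
  faceIso : Face carrier ≃o Set.Ici G

/-- The face `A*` of the quotient polytope that corresponds to the face `A ⊇ G` of `P`. -/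
def QuotientPolytope.star {d : ℕ} {P : Set (Euc d)} {G : Face P} {e : ℕ}
    (Q : QuotientPolytope P G e) (A : Set (Euc d)) : Set (Euc e) :=
  {q | ∃ f : Face Q.carrier, (Q.faceIso f).1.1 = A ∧ q ∈ f.1}

/-- `p` is the vertex of the quotient polytope that corresponds to the point `v` of `P`: the face
`{p}` of the quotient corresponds to the least face of `P` that contains both `G` and `v`. -/
def QuotientPolytope.IsStarVertex {d : ℕ} {P : Set (Euc d)} {G : Face P} {e : ℕ}
    (Q : QuotientPolytope P G e) (v : Euc d) (p : Euc e) : Prop :=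
  ∃ f : Face Q.carrier, f.1 = {p} ∧ IsLeast {F : Face P | G ≤ F ∧ v ∈ F.1} (Q.faceIso f).1

/-- `φ` restricts to a bijection between the vertices of `P` and of `Q` that is induced by an
isomorphism of the face lattices. -/
def IsCombinatorialIso {d e : ℕ} (P : Set (Euc d)) (Q : Set (Euc e)) (φ : Euc d → Euc e) : Prop :=
  Set.BijOn φ (vertices P) (vertices Q) ∧
    ∃ ψ : Face P ≃o Face Q, ∀ F : Face P, (ψ F).1 ∩ vertices Q = φ '' (F.1 ∩ vertices P)

end Sewing

/-! ### Exposing functionals and hyperplanes. -/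

namespace Sewing
open Set

variable {d : ℕ} {R F E : Set (Euc d)}

/-! Everything reduces to a parity count. Give a facet of `P` the level `n`, the largest `j` with
`Φ_j` contained in it (0 if there is none); the sewn point is beyond the facet exactly when `n` is
odd (`IsLevel.mem_beyondFacets_iff`). Facets of `P/Φ_i` are the facets of `P` of level `n ≥ i`, and
their level in the quotient chain is `n - i` (`IsLevel.quotient`).

If a new point `z` avoids all facet hyperplanes of `R`, a face `E` of `R` in a facet beneath `z`
survives in `[R, z]`, and `[E, z]` is a face if `E` lies in a facet beyond which `z` lies and in one
beneath which it lies. Conversely, proper faces `H` of `[R, z]` arise so, with `E = H ∩ R`, as long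
as `H` is nonempty and, when `z ∈ H`, `E` is nonempty.

Let `K` be a proper face of `P^+` containing `[Φ_{i-1}, x_i, z]`, with trace `E = K ∩ P`. If `y_i ∈
E`, then `Φ_i ⊆ E`; facets of both parities contain `E`, so the quotient face given by `E` can be
joined to `ybar`. If `y_i ∉ E`, some facet of level exactly `i - 1` contains `E`, and a facet of the
other parity must contain it too. That one has level at least `i`, hence contains `y_i`, and `ybar`
is beneath its image. As proper faces of `P` are simplices (`IsNeighbourly.isFace_convexHull`), `[E,
y_i]` is a face, and its image in the quotient survives the sewing. Both steps reverse, so `ybar`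
takes the role of `y_i`.

To make this an isomorphism, each face on either side is encoded by a set of vertices of `P`
(`quotientCode`, `sewnCode`). Both codes are order embeddings, and `exists_sewnCode_eq` and
`exists_quotientCode_eq` show that they have the same range. Vertices are then matched through their
one-element codes; universality of `Φ_i` makes every `v*` exist. -/

theorem IsFace.exists_functional (hF : IsFace R F) (hne : F.Nonempty) :
    ∃ (l : Euc d →ₗ[ℝ] ℝ) (c : ℝ), (∀ p ∈ R, l p ≤ c) ∧ F = {p ∈ R | l p = c} := by
  obtain ⟨l, hl⟩ := hF hne
  obtain ⟨x₀, hx₀⟩ := hne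
  have hx := hx₀
  rw [hl] at hx
  refine ⟨l, l x₀, hx.2, ?_⟩
  ext p
  rw [hl]
  constructor
  · rintro ⟨hp, h⟩
    exact ⟨hp, le_antisymm (hx.2 p hp) (h _ hx.1)⟩
  · rintro ⟨hp, h⟩
    refine ⟨hp, fun y hy => ?_⟩
    have h' : l p = l x₀ := h
    rw [h']
    exact hx.2 y hy

theorem isFace_setOf (l : Euc d →ₗ[ℝ] ℝ) (c : ℝ) (h : ∀ p ∈ R, l p ≤ c) :
    IsFace R {p ∈ R | l p = c} := by
  rintro ⟨x₀, hx₀, h₀⟩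
  refine ⟨LinearMap.toContinuousLinearMap l, ?_⟩
  ext p
  simp only [mem_ofPred_eq, LinearMap.coe_toContinuousLinearMap']
  constructor
  · rintro ⟨hp, hpc⟩
    exact ⟨hp, fun y hy => hpc ▸ h y hy⟩
  · rintro ⟨hp, hpc⟩
    exact ⟨hp, le_antisymm (h p hp) (h₀ ▸ hpc x₀ hx₀)⟩

theorem vectorSpan_le_ker {l : Euc d →ₗ[ℝ] ℝ} {c : ℝ} (hF : ∀ p ∈ F, l p = c) :
    vectorSpan ℝ F ≤ LinearMap.ker l := by
  rw [vectorSpan_def, Submodule.span_le]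
  rintro _ ⟨a, ha, b, hb, rfl⟩
  simp [hF a ha, hF b hb]

theorem finrank_ker_add_one {l : Euc d →ₗ[ℝ] ℝ} (hl : l ≠ 0) :
    Module.finrank ℝ (LinearMap.ker l) + 1 = d := by
  have hk : Module.finrank ℝ (LinearMap.ker l) + 1 = Module.finrank ℝ (Euc d) :=
    Module.Dual.finrank_ker_add_one_of_ne_zero hl
  rwa [finrank_euclideanSpace_fin] at hk

theorem dim_add_one_le {l : Euc d →ₗ[ℝ] ℝ} {c : ℝ} (hl : l ≠ 0) (hF : ∀ p ∈ F, l p = c) :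
    dim F + 1 ≤ d := by
  have := Submodule.finrank_mono (vectorSpan_le_ker hF)
  have := finrank_ker_add_one hl
  unfold dim
  omega

theorem affineSpan_eq_hyperplane {l : Euc d →ₗ[ℝ] ℝ} {c : ℝ} (hl : l ≠ 0) (hne : F.Nonempty)
    (hF : ∀ p ∈ F, l p = c) (hdim : d ≤ dim F + 1) (w : Euc d) :
    w ∈ affineSpan ℝ F ↔ l w = c := by
  obtain ⟨p₀, hp₀⟩ := hne
  have hle := vectorSpan_le_ker hF
  have hk := finrank_ker_add_one hl
  have heq : vectorSpan ℝ F = LinearMap.ker l := by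
    apply Submodule.eq_of_le_of_finrank_le hle
    unfold dim at hdim
    omega
  rw [← AffineSubspace.vsub_right_mem_direction_iff_mem (mem_affineSpan ℝ hp₀),
    direction_affineSpan, heq, LinearMap.mem_ker, vsub_eq_sub, map_sub, hF p₀ hp₀, sub_eq_zero]

namespace IsFullPolytope

theorem convex (hR : IsFullPolytope R) : Convex ℝ R := by
  obtain ⟨⟨s, rfl⟩, -⟩ := hR
  exact convex_convexHull ℝ _

theorem isCompact (hR : IsFullPolytope R) : IsCompact R := by
  obtain ⟨⟨s, rfl⟩, -⟩ := hR
  exact Set.Finite.isCompact_convexHull (𝕜 := ℝ) s.finite_toSet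

theorem interior_nonempty (hR : IsFullPolytope R) : (interior R).Nonempty :=
  (Convex.interior_nonempty_iff_affineSpan_eq_top hR.convex).2 hR.2

theorem nonempty (hR : IsFullPolytope R) : R.Nonempty := hR.interior_nonempty.mono interior_subset

theorem dim_eq (hR : IsFullPolytope R) : dim R = d := by
  unfold dim
  rw [← direction_affineSpan, hR.2, AffineSubspace.direction_top, finrank_top,
    finrank_euclideanSpace_fin]

end IsFullPolytope

end Sewing

/-! ### Facets separating an outside point, by polarity. -/

namespace Sewing
open Set Filter Topology
open scoped RealInnerProductSpace

variable {d : ℕ} {R F E : Set (Euc d)}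

/-- Under a small perturbation only the tight inequalities matter. All later arguments that move a
point slightly inside a polytope rest on this. -/
theorem eventually_add_mul_nonpos {a b : ℝ} (ha : a ≤ 0) (hb : a = 0 → b ≤ 0) :
    ∀ᶠ ε in 𝓝[>] (0 : ℝ), a + ε * b ≤ 0 := by
  rcases ha.eq_or_lt with h | h
  · filter_upwards [self_mem_nhdsWithin] with ε hε
    rw [h, zero_add]
    exact mul_nonpos_of_nonneg_of_nonpos (le_of_lt hε) (hb h)
  · have hc : Tendsto (fun ε : ℝ => a + ε * b) (𝓝[>] 0) (𝓝 (a + 0 * b)) := by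
      apply tendsto_nhdsWithin_of_tendsto_nhds
      exact Continuous.tendsto (by fun_prop) 0
    rw [zero_mul, add_zero] at hc
    filter_upwards [hc.eventually_lt_const h] with ε hε using hε.le

theorem exists_pos_of_eventually {p : ℝ → Prop} (h : ∀ᶠ ε in 𝓝[>] (0 : ℝ), p ε) :
    ∃ ε > 0, p ε := by
  obtain ⟨ε, h1, h2⟩ := (h.and self_mem_nhdsWithin).exists
  exact ⟨ε, h2, h1⟩

theorem inner_sub_le_one_of_mem_convexHull {S : Set (Euc d)} {u o : Euc d}
    (h : ∀ p ∈ S, ⟪u, p - o⟫ ≤ 1) : ∀ p ∈ convexHull ℝ S, ⟪u, p - o⟫ ≤ 1 := by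
  have hc : Convex ℝ {p : Euc d | innerₛₗ ℝ u p ≤ 1 + ⟪u, o⟫} :=
    convex_halfSpace_le (innerₛₗ ℝ u).isLinear _
  have hsub : S ⊆ {p : Euc d | innerₛₗ ℝ u p ≤ 1 + ⟪u, o⟫} := by
    intro p hp
    have := h p hp
    rw [inner_sub_right] at this
    simp only [mem_ofPred_eq, innerₛₗ_apply_apply]
    linarith
  intro p hp
  have := convexHull_min hsub hc hp
  simp only [mem_ofPred_eq, innerₛₗ_apply_apply] at this
  rw [inner_sub_right]
  linarith

/-- The polar body of a set about an interior point of it is compact. -/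
theorem isCompact_polar {o : Euc d} (ho : o ∈ interior R) :
    IsCompact {u : Euc d | ∀ p ∈ R, ⟪u, p - o⟫ ≤ 1} := by
  obtain ⟨r, hr, hball⟩ := Metric.isOpen_iff.1 isOpen_interior o ho
  apply Metric.isCompact_of_isClosed_isBounded
  · simp only [ofPred_forall]
    refine isClosed_biInter fun p _ => ?_
    exact isClosed_le (by fun_prop) continuous_const
  · refine (Metric.isBounded_closedBall (x := (0 : Euc d)) (r := 2 / r)).subset fun u hu => ?_
    rw [mem_closedBall_zero_iff]
    rcases eq_or_ne u 0 with rfl | hu0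
    · simp only [norm_zero]; positivity
    have hn : 0 < ‖u‖ := norm_pos_iff.2 hu0
    have hmem : o + (r / 2 / ‖u‖) • u ∈ R := by
      apply interior_subset
      apply hball
      rw [Metric.mem_ball, dist_eq_norm, add_sub_cancel_left, norm_smul, Real.norm_of_nonneg
        (by positivity), div_mul_cancel₀ _ hn.ne']
      linarith
    have := hu _ hmem
    rw [add_sub_cancel_left, inner_smul_right, real_inner_self_eq_norm_sq] at this
    rw [le_div_iff₀ hr]
    have h2 : r / 2 / ‖u‖ * ‖u‖ ^ 2 = r / 2 * ‖u‖ := by field_simp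
    rw [h2] at this
    linarith

/-- Vertices of the polar body are facets of `R`. Separation gives a polar point whose value at `w`
exceeds 1; maximizing that value over the compact polar body leads to an extreme point with the same
property, and its tight constraints cut out the facet. -/
theorem IsFullPolytope.exists_isBeyond (hR : IsFullPolytope R) (hd : 0 < d) {w : Euc d}
    (hw : w ∉ R) : ∃ F ∈ facets R, IsBeyond R F w := by
  obtain ⟨o, ho⟩ := hR.interior_nonempty
  have hoR := interior_subset ho
  set K : Set (Euc d) := {u : Euc d | ∀ p ∈ R, ⟪u, p - o⟫ ≤ 1} with hKdef
  have hKc : IsCompact K := isCompact_polar ho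
  obtain ⟨f, t, hft, htw⟩ :=
    geometric_hahn_banach_closed_point hR.convex hR.isCompact.isClosed hw
  have ht : 0 < t - f o := sub_pos.2 (hft o hoR)
  set u₀ : Euc d := (t - f o)⁻¹ • (InnerProductSpace.toDual ℝ (Euc d)).symm f with hu₀
  have hu₀i : ∀ p, ⟪u₀, p - o⟫ = (t - f o)⁻¹ * (f p - f o) := by
    intro p
    rw [hu₀, real_inner_smul_left, InnerProductSpace.toDual_symm_apply, map_sub]
  have hu₀K : u₀ ∈ K := by
    intro p hp
    rw [hu₀i, inv_mul_le_iff₀ ht]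
    linarith [hft p hp]
  have hu₀w : 1 < ⟪u₀, w - o⟫ := by
    rw [hu₀i, lt_inv_mul_iff₀ ht]
    linarith
  let L : StrongDual ℝ (Euc d) := innerSL ℝ (w - o)
  have hB : IsExposed ℝ K (L.toExposed K) := ContinuousLinearMap.toExposed.isExposed
  obtain ⟨v, hvK, hv⟩ := hKc.exists_isMaxOn ⟨u₀, hu₀K⟩ L.continuous.continuousOn
  obtain ⟨u, hu⟩ := (hB.isCompact hKc).extremePoints_nonempty ⟨v, hvK, hv⟩
  have huB : u ∈ L.toExposed K := extremePoints_subset hu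
  have huK : u ∈ K := huB.1
  have hux : u ∈ K.extremePoints ℝ := hB.isExtreme.extremePoints_subset_extremePoints hu
  have huw : 1 < ⟪u, w - o⟫ := by
    have := huB.2 u₀ hu₀K
    simp only [L, innerSL_apply_apply] at this
    rw [real_inner_comm] at this
    rw [real_inner_comm (w - o) u]
    linarith [real_inner_comm u₀ (w - o)]
  obtain ⟨s, hs⟩ := hR.1
  -- the constraints active at an extreme point of the polar body determine it
  have hact : ∀ x : Euc d, (∀ p ∈ s, ⟪u, p - o⟫ = 1 → ⟪x, p - o⟫ = 0) → x = 0 := by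
    intro x hx
    -- Slack constraints tolerate a small perturbation and tight ones do not change along `x`, so `u
    -- ± ε x` both stay in the polar body, against extremality unless `x = 0`.
    have hev : ∀ᶠ ε in 𝓝[>] (0 : ℝ), ∀ p ∈ s,
        (⟪u, p - o⟫ - 1) + ε * ⟪x, p - o⟫ ≤ 0 ∧ (⟪u, p - o⟫ - 1) + ε * (-⟪x, p - o⟫) ≤ 0 := by
      rw [eventually_all_finset]
      intro p hp
      have h1 : ⟪u, p - o⟫ - 1 ≤ 0 :=
        sub_nonpos.2 (huK p (hs ▸ subset_convexHull ℝ _ hp))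
      refine (eventually_add_mul_nonpos h1 fun h => ?_).and
        (eventually_add_mul_nonpos h1 fun h => ?_)
      · rw [hx p hp (by linarith)]
      · rw [hx p hp (by linarith), neg_zero]
    obtain ⟨ε, hε, hall⟩ := exists_pos_of_eventually hev
    have hmem : ∀ σ : ℝ, (σ = 1 ∨ σ = -1) → u + (σ * ε) • x ∈ K := by
      intro σ hσ
      rw [hKdef, hs]
      apply inner_sub_le_one_of_mem_convexHull
      intro p hp
      have := hall p hp
      rw [inner_add_left, real_inner_smul_left]
      rcases hσ with rfl | rfl
      · linarith [this.1]
      · linarith [this.2]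
    have hseg : u ∈ openSegment ℝ (u + (1 * ε) • x) (u + (-1 * ε) • x) := by
      refine ⟨1 / 2, 1 / 2, by norm_num, by norm_num, by norm_num, ?_⟩
      module
    have := (mem_extremePoints.1 hux).2 _ (hmem 1 (Or.inl rfl)) _ (hmem (-1) (Or.inr rfl)) hseg
    have h0 : (1 * ε) • x = 0 := by simpa using this.1
    rcases smul_eq_zero.1 h0 with h | h
    · linarith
    · exact h
  have : Nontrivial (Euc d) := by
    have : Nonempty (Fin d) := ⟨⟨0, hd⟩⟩
    infer_instance
  obtain ⟨a, has, ha⟩ : ∃ a ∈ s, ⟪u, a - o⟫ = 1 := by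
    by_contra! h
    obtain ⟨x, hx⟩ := exists_ne (0 : Euc d)
    exact hx (hact x fun p hp h1 => absurd h1 (h p hp))
  have haR : a ∈ R := hs ▸ subset_convexHull ℝ _ has
  set l : Euc d →ₗ[ℝ] ℝ := innerₛₗ ℝ u with hl
  have hlapp : ∀ p, l p = ⟪u, p - o⟫ + ⟪u, o⟫ := by
    intro p
    rw [hl, innerₛₗ_apply_apply, inner_sub_right, sub_add_cancel]
  set c : ℝ := 1 + ⟪u, o⟫ with hc
  have hl0 : l ≠ 0 := by
    intro h
    have h1 := hlapp a
    have h2 := hlapp o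
    rw [h] at h1 h2
    simp only [LinearMap.zero_apply, sub_self, inner_zero_right] at h1 h2
    linarith
  have hle : ∀ p ∈ R, l p ≤ c := by
    intro p hp
    rw [hlapp]
    linarith [huK p hp]
  have hne : {p ∈ R | l p = c}.Nonempty := ⟨a, haR, by rw [hlapp, ha]⟩
  have hdim : d ≤ dim {p ∈ R | l p = c} + 1 := by
    set V := vectorSpan ℝ {p ∈ R | l p = c} with hV
    have htop : V ⊔ Submodule.span ℝ {a - o} = ⊤ := by
      -- A vector orthogonal to this sum is orthogonal to `p - o` for every tight `p`, so `hact`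
      -- makes it zero.
      rw [← Submodule.orthogonal_eq_bot_iff, Submodule.eq_bot_iff]
      intro x hx
      rw [Submodule.mem_orthogonal] at hx
      apply hact
      intro p hp hp1
      have h1 : p - a ∈ V := vsub_mem_vectorSpan ℝ
        ⟨hs ▸ subset_convexHull ℝ _ hp, by rw [hlapp, hp1]⟩ ⟨haR, by rw [hlapp, ha]⟩
      have h2 : p - o = (p - a) + (a - o) := by abel
      rw [real_inner_comm, h2]
      exact hx _ (add_mem (Submodule.mem_sup_left h1)
        (Submodule.mem_sup_right (Submodule.mem_span_singleton_self _)))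
    have h1 := Submodule.finrank_add_le_finrank_add_finrank V (Submodule.span ℝ {a - o})
    rw [htop, finrank_top, finrank_euclideanSpace_fin] at h1
    have h2 := finrank_span_le_card (R := ℝ) ({a - o} : Set (Euc d))
    simp only [toFinset_singleton, Finset.card_singleton] at h2
    change d ≤ Module.finrank ℝ V + 1
    omega
  refine ⟨{p ∈ R | l p = c}, ⟨isFace_setOf l c hle, hne, ?_⟩, l, c,
    affineSpan_eq_hyperplane hl0 hne (fun p hp => hp.2) hdim, hle, ?_⟩
  · rw [hR.dim_eq]
    exact le_antisymm (dim_add_one_le hl0 fun p hp => hp.2) hdim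
  · rw [hlapp]
    linarith

end Sewing

/-! ### Faces as intersections of facets, vertices, and isomorphisms of face lattices. -/

namespace Sewing
open Set Filter Topology

variable {d : ℕ} {R F E C : Set (Euc d)}

/-- The hyperplane `l = c` is the affine hull of `F` and supports `R`. -/
def Supports (R F : Set (Euc d)) (l : Euc d →ₗ[ℝ] ℝ) (c : ℝ) : Prop :=
  (∀ w, w ∈ affineSpan ℝ F ↔ l w = c) ∧ ∀ p ∈ R, l p ≤ c

theorem Supports.mem_iff {l : Euc d →ₗ[ℝ] ℝ} {c : ℝ} (h : Supports R F l c) (hF : IsFace R F)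
    (hne : F.Nonempty) {p : Euc d} : p ∈ F ↔ p ∈ R ∧ l p = c := by
  obtain ⟨l', c', -, hF'⟩ := hF.exists_functional hne
  refine ⟨fun hp => ⟨hF.subset hp, (h.1 p).1 (mem_affineSpan ℝ hp)⟩, fun ⟨hp, hpc⟩ => ?_⟩
  have hspan : ∀ w ∈ affineSpan ℝ F, l' w = c' := by
    intro w hw
    obtain ⟨p₀, hp₀⟩ := hne
    have h0 : ∀ q ∈ F, l' q = c' := fun q hq => by rw [hF'] at hq; exact hq.2
    have h1 : w -ᵥ p₀ ∈ vectorSpan ℝ F := by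
      rw [← direction_affineSpan]
      exact AffineSubspace.vsub_mem_direction hw (mem_affineSpan ℝ hp₀)
    have h2 := vectorSpan_le_ker h0 h1
    rw [LinearMap.mem_ker, vsub_eq_sub, map_sub, h0 p₀ hp₀] at h2
    linarith
  rw [hF']
  exact ⟨hp, hspan p ((h.1 p).2 hpc)⟩

theorem exists_mem_notMem_of_mem_facets (hF : F ∈ facets R) : ∃ r ∈ R, r ∉ F := by
  by_contra! h
  have : F = R := hF.1.subset.antisymm h
  have := hF.2.2
  rw [‹F = R›] at this
  omega

theorem Supports.exists_lt {l : Euc d →ₗ[ℝ] ℝ} {c : ℝ} (h : Supports R F l c)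
    (hF : F ∈ facets R) : ∃ r ∈ R, l r < c := by
  obtain ⟨r, hr, hrF⟩ := exists_mem_notMem_of_mem_facets hF
  exact ⟨r, hr, lt_of_le_of_ne (h.2 r hr) fun h' => hrF ((h.mem_iff hF.1 hF.2.1).2 ⟨hr, h'⟩)⟩

/-- Being beyond a facet does not depend on the functional chosen: if `l` and `l'` disagreed at `z`,
a segment from a point of `R` off the facet to `z` would cross the hyperplane for `l` while staying
strictly on one side for `l'`. -/
theorem Supports.lt_of_lt {l l' : Euc d →ₗ[ℝ] ℝ} {c c' : ℝ} (h : Supports R F l c)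
    (h' : Supports R F l' c') (hF : F ∈ facets R) {z : Euc d} (hz : c < l z) : c' < l' z := by
  by_contra hcon
  obtain ⟨r, hr, hlr⟩ := h.exists_lt hF
  have hlt : l' z < c' := by
    refine lt_of_le_of_ne (not_lt.1 hcon) fun h1 => ?_
    have := (h.1 z).1 ((h'.1 z).2 h1)
    linarith
  have hlr' : l' r < c' := by
    refine lt_of_le_of_ne (h'.2 r hr) fun h1 => ?_
    have := (h.1 r).1 ((h'.1 r).2 h1)
    linarith
  -- the point of the segment from `r` to `z` on the hyperplane `l = c`
  have hpos : 0 < l z - l r := by linarith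
  have hne : l z - l r ≠ 0 := hpos.ne'
  set t : ℝ := (c - l r) / (l z - l r) with ht
  have ht0 : 0 < t := div_pos (by linarith) hpos
  have ht1 : t < 1 := (div_lt_one hpos).2 (by linarith)
  have hq : l ((1 - t) • r + t • z) = c := by
    have h2 : t * (l z - l r) = c - l r := div_mul_cancel₀ _ hne
    simp only [map_add, map_smul, smul_eq_mul]
    linarith
  have hq' := (h'.1 _).1 ((h.1 _).2 hq)
  simp only [map_add, map_smul, smul_eq_mul] at hq'
  nlinarith

theorem isBeyond_iff {l : Euc d →ₗ[ℝ] ℝ} {c : ℝ} (h : Supports R F l c) (hF : F ∈ facets R)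
    {z : Euc d} : IsBeyond R F z ↔ c < l z :=
  ⟨fun ⟨_, _, h1, h2, h3⟩ => Supports.lt_of_lt ⟨h1, h2⟩ h hF h3, fun hz => ⟨l, c, h.1, h.2, hz⟩⟩

theorem isBeneath_iff {l : Euc d →ₗ[ℝ] ℝ} {c : ℝ} (h : Supports R F l c) (hF : F ∈ facets R)
    {z : Euc d} : IsBeneath R F z ↔ l z < c := by
  refine ⟨fun ⟨l', c', h1, h2, h3⟩ => ?_, fun hz => ⟨l, c, h.1, h.2, hz⟩⟩
  by_contra hcon
  rcases (not_lt.1 hcon).eq_or_lt with h4 | h4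
  · have := (h1 z).1 ((h.1 z).2 h4.symm)
    linarith
  · have := Supports.lt_of_lt h (l' := l') (c' := c') ⟨h1, h2⟩ hF h4
    linarith

theorem IsFullPolytope.exists_supports (hR : IsFullPolytope R) (hF : F ∈ facets R) :
    ∃ (l : Euc d →ₗ[ℝ] ℝ) (c : ℝ), Supports R F l c := by
  obtain ⟨l, c, hle, heq⟩ := hF.1.exists_functional hF.2.1
  refine ⟨l, c, affineSpan_eq_hyperplane ?_ hF.2.1 (fun p hp => ?_) ?_, hle⟩
  · rintro rfl
    obtain ⟨r, hr, hrF⟩ := exists_mem_notMem_of_mem_facets hF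
    obtain ⟨q, hq⟩ := hF.2.1
    apply hrF
    rw [heq] at hq ⊢
    exact ⟨hr, by simpa using hq.2⟩
  · rw [heq] at hp
    exact hp.2
  · rw [hF.2.2, hR.dim_eq]

/-- A choice of supporting functionals for all facets. -/
def FacetFunctionals (R : Set (Euc d)) (l : Set (Euc d) → Euc d →ₗ[ℝ] ℝ)
    (c : Set (Euc d) → ℝ) : Prop :=
  ∀ F ∈ facets R, Supports R F (l F) (c F)

theorem IsFullPolytope.exists_facetFunctionals (hR : IsFullPolytope R) :
    ∃ l c, FacetFunctionals R l c := by
  classical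
  have h : ∀ F : Set (Euc d), ∃ (l : Euc d →ₗ[ℝ] ℝ) (c : ℝ), F ∈ facets R → Supports R F l c := by
    intro F
    by_cases hF : F ∈ facets R
    · obtain ⟨l, c, h⟩ := hR.exists_supports hF
      exact ⟨l, c, fun _ => h⟩
    · exact ⟨0, 0, fun h => absurd h hF⟩
  choose l c h using h
  exact ⟨l, c, h⟩

theorem IsFullPolytope.mem_of_forall_le (hR : IsFullPolytope R) (hd : 0 < d)
    {l : Set (Euc d) → Euc d →ₗ[ℝ] ℝ} {c : Set (Euc d) → ℝ} (hl : FacetFunctionals R l c)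
    {w : Euc d} (hw : ∀ F ∈ facets R, l F w ≤ c F) : w ∈ R := by
  by_contra hwR
  obtain ⟨F, hF, hb⟩ := hR.exists_isBeyond hd hwR
  exact absurd ((isBeyond_iff (hl F hF) hF).1 hb) (not_lt.2 (hw F hF))

theorem IsFace.eq_convexHull_inter {S : Set (Euc d)} (hE : IsFace (convexHull ℝ S) E) :
    E = convexHull ℝ (E ∩ S) := by
  have hconv : Convex ℝ E := hE.convex (convex_convexHull ℝ S)
  refine Subset.antisymm ?_ (convexHull_min inter_subset_left hconv)
  rcases E.eq_empty_or_nonempty with rfl | hne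
  · exact empty_subset _
  obtain ⟨l, c, hle, hEeq⟩ := hE.exists_functional hne
  -- This set contains `S` and is convex, because a proper convex combination reaches the maximum
  -- `c` only if both ends do. It therefore contains the whole hull.
  set T : Set (Euc d) := {w | l w ≤ c ∧ (l w = c → w ∈ convexHull ℝ (E ∩ S))} with hT
  have hTc : Convex ℝ T := by
    rw [convex_iff_forall_pos]
    rintro x ⟨hx1, hx2⟩ y ⟨hy1, hy2⟩ a b ha hb hab
    have hlin : l (a • x + b • y) = a * l x + b * l y := by simp
    have hac : a * c + b * c = c := by rw [← add_mul, hab, one_mul]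
    have hax := mul_le_mul_of_nonneg_left hx1 ha.le
    have hby := mul_le_mul_of_nonneg_left hy1 hb.le
    refine ⟨?_, fun h => ?_⟩
    · rw [hlin]; linarith
    · rw [hlin] at h
      have hx : l x = c := by
        by_contra hne
        have := mul_lt_mul_of_pos_left (lt_of_le_of_ne hx1 hne) ha
        linarith
      have hy : l y = c := by
        by_contra hne
        have := mul_lt_mul_of_pos_left (lt_of_le_of_ne hy1 hne) hb
        linarith
      exact convex_convexHull ℝ _ (hx2 hx) (hy2 hy) ha.le hb.le hab
  have hST : S ⊆ T := fun p hp =>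
    ⟨hle p (subset_convexHull ℝ S hp), fun h => subset_convexHull ℝ _
      ⟨by rw [hEeq]; exact ⟨subset_convexHull ℝ S hp, h⟩, hp⟩⟩
  intro w hw
  have hwT := convexHull_min hST hTc (hE.subset hw)
  rw [hEeq] at hw
  exact hwT.2 hw.2

theorem IsFullPolytope.finite_faces (hR : IsFullPolytope R) : {F | IsFace R F}.Finite := by
  obtain ⟨⟨s, rfl⟩, -⟩ := hR
  refine (s.finite_toSet.finite_subsets.image fun A => convexHull ℝ A).subset fun F hF => ?_
  exact ⟨F ∩ s, inter_subset_right, hF.eq_convexHull_inter.symm⟩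

theorem IsFullPolytope.finite_facets (hR : IsFullPolytope R) : (facets R).Finite :=
  hR.finite_faces.subset fun _ h => h.1

theorem IsFullPolytope.eventually_add_smul_mem (hR : IsFullPolytope R) (hd : 0 < d)
    {l : Set (Euc d) → Euc d →ₗ[ℝ] ℝ} {c : Set (Euc d) → ℝ} (hl : FacetFunctionals R l c)
    {e u : Euc d} (he : e ∈ R) (hu : ∀ F ∈ facets R, e ∈ F → l F u ≤ 0) :
    ∀ᶠ ε in 𝓝[>] (0 : ℝ), e + ε • u ∈ R := by
  have : ∀ᶠ ε in 𝓝[>] (0 : ℝ), ∀ F ∈ facets R, (l F e - c F) + ε * l F u ≤ 0 := by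
    rw [eventually_all_finite hR.finite_facets]
    intro F hF
    refine eventually_add_mul_nonpos (sub_nonpos.2 ((hl F hF).2 e he)) fun h => ?_
    exact hu F hF (((hl F hF).mem_iff hF.1 hF.2.1).2 ⟨he, by linarith⟩)
  filter_upwards [this] with ε hε
  refine hR.mem_of_forall_le hd hl fun F hF => ?_
  have := hε F hF
  simp only [map_add, map_smul, smul_eq_mul]
  linarith

/-- A nonempty convex subset of `R` contains a point that lies only in those facets that contain
the whole subset. -/
theorem IsFullPolytope.exists_mem_forall_facet (hR : IsFullPolytope R) (hC : Convex ℝ C)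
    (hCR : C ⊆ R) (hne : C.Nonempty) : ∃ e ∈ C, ∀ F ∈ facets R, e ∈ F → C ⊆ F := by
  classical
  have key : ∀ T : Finset (Set (Euc d)), (∀ F ∈ T, F ∈ facets R) →
      ∃ e ∈ C, ∀ F ∈ T, e ∈ F → C ⊆ F := by
    intro T
    induction T using Finset.induction_on with
    | empty => exact fun _ => ⟨hne.some, hne.some_mem, by simp⟩
    | insert F₀ T _ ih =>
      intro hT
      obtain ⟨e, he, heT⟩ := ih fun F hF => hT F (Finset.mem_insert_of_mem hF)
      by_cases hCF : C ⊆ F₀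
      · refine ⟨e, he, fun F hF => ?_⟩
        rcases Finset.mem_insert.1 hF with rfl | hF
        · exact fun _ => hCF
        · exact heT F hF
      obtain ⟨e₀, he₀, he₀F⟩ := not_subset.1 hCF
      -- A facet containing the midpoint contains both ends, so the midpoint avoids every facet that
      -- either end avoids.
      have hseg : (1 / 2 : ℝ) • e + (1 / 2 : ℝ) • e₀ ∈ openSegment ℝ e e₀ :=
        ⟨1 / 2, 1 / 2, by norm_num, by norm_num, by norm_num, rfl⟩
      refine ⟨_, hC.openSegment_subset he he₀ hseg, fun F hF hmem => ?_⟩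
      have hext := (hT F hF).1.isExtreme
      rcases Finset.mem_insert.1 hF with rfl | hF
      · exact absurd (hext.right_mem_of_mem_openSegment (hCR he) (hCR he₀) hmem hseg) he₀F
      · exact heT F hF (hext.2 (hCR he) (hCR he₀) hmem hseg)
  obtain ⟨e, he, h⟩ := key hR.finite_facets.toFinset fun F hF => by simpa using hF
  exact ⟨e, he, fun F hF => h F (by simpa using hF)⟩

/-- From a point `e` of `C` lying in as few facets as possible, one can move a little away from `w`
without leaving `R`. Then `e` is interior to a segment of `R` ending at `w`, and extremality puts
`w` in `C`. -/
theorem IsFullPolytope.mem_of_forall_facet (hR : IsFullPolytope R) (hd : 0 < d)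
    (hC : Convex ℝ C) (hext : IsExtreme ℝ R C) (hne : C.Nonempty) {w : Euc d} (hw : w ∈ R)
    (h : ∀ F ∈ facets R, C ⊆ F → w ∈ F) : w ∈ C := by
  obtain ⟨l, c, hl⟩ := hR.exists_facetFunctionals
  obtain ⟨e, he, heF⟩ := hR.exists_mem_forall_facet hC hext.subset hne
  have heR := hext.subset he
  have hev := hR.eventually_add_smul_mem hd hl (u := e - w) heR fun F hF heF' => by
    have h1 := ((hl F hF).mem_iff hF.1 hF.2.1).1 heF'
    have h2 := ((hl F hF).mem_iff hF.1 hF.2.1).1 (h F hF (heF F hF heF'))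
    rw [map_sub, h1.2, h2.2, sub_self]
  obtain ⟨ε, hε, hmem⟩ := exists_pos_of_eventually hev
  refine hext.2 hw hmem he ?_
  have h1 : (1 + ε) ≠ 0 := by positivity
  refine ⟨ε / (1 + ε), 1 / (1 + ε), by positivity, by positivity, by field_simp; ring, ?_⟩
  have h2 : ε / (1 + ε) = 1 - 1 / (1 + ε) := by field_simp; ring
  have h3 : 1 / (1 + ε) * ε = 1 - 1 / (1 + ε) := by field_simp; ring
  rw [smul_add, smul_smul, h3, h2]
  module

theorem IsFullPolytope.exists_facet_notMem (hR : IsFullPolytope R) (hd : 0 < d)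
    (hE : IsFace R E) (hne : E.Nonempty) {w : Euc d} (hw : w ∈ R) (hwE : w ∉ E) :
    ∃ F ∈ facets R, E ⊆ F ∧ w ∉ F := by
  by_contra! h
  exact hwE (hR.mem_of_forall_facet hd (hE.convex hR.convex) hE.isExtreme hne hw h)

theorem IsFullPolytope.exists_facet_supset (hR : IsFullPolytope R) (hd : 0 < d)
    (hE : IsFace R E) (hne : E.Nonempty) (hER : E ≠ R) : ∃ F ∈ facets R, E ⊆ F := by
  obtain ⟨w, hw, hwE⟩ : ∃ w ∈ R, w ∉ E := by
    by_contra! h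
    exact hER (hE.subset.antisymm h)
  obtain ⟨F, hF, h, -⟩ := hR.exists_facet_notMem hd hE hne hw hwE
  exact ⟨F, hF, h⟩

/-- The sum of the functionals of all facets containing `C` exposes the intersection of these facets
with `R`, which is `C`. Extremality is transitive, so this is the way to show that faces of faces
are faces. -/
theorem IsFullPolytope.isFace_of_isExtreme (hR : IsFullPolytope R) (hd : 0 < d)
    (hC : Convex ℝ C) (hext : IsExtreme ℝ R C) : IsFace R C := by
  classical
  rcases C.eq_empty_or_nonempty with rfl | hne
  · exact isExposed_empty
  obtain ⟨l, c, hl⟩ := hR.exists_facetFunctionals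
  have hfin : {F | F ∈ facets R ∧ C ⊆ F}.Finite := hR.finite_facets.subset fun _ h => h.1
  have hmem : ∀ F ∈ hfin.toFinset, F ∈ facets R ∧ C ⊆ F := fun F hF => by simpa using hF
  have hle : ∀ p ∈ R, ∀ F ∈ hfin.toFinset, l F p ≤ c F := fun p hp F hF =>
    (hl F (hmem F hF).1).2 p hp
  convert isFace_setOf (R := R) (∑ F ∈ hfin.toFinset, l F) (∑ F ∈ hfin.toFinset, c F) ?_ using 1
  · ext p
    simp only [mem_ofPred_eq, LinearMap.sum_apply]
    refine ⟨fun hp => ⟨hext.subset hp, Finset.sum_congr rfl fun F hF => ?_⟩, fun ⟨hp, hsum⟩ => ?_⟩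
    · obtain ⟨hF, hCF⟩ := hmem F hF
      exact (((hl F hF).mem_iff hF.1 hF.2.1).1 (hCF hp)).2
    · refine hR.mem_of_forall_facet hd hC hext hne hp fun F hF hCF => ?_
      have := (Finset.sum_eq_sum_iff_of_le (hle p hp)).1 hsum F (by simpa using ⟨hF, hCF⟩)
      exact ((hl F hF).mem_iff hF.1 hF.2.1).2 ⟨hp, this⟩
  · intro p hp
    rw [LinearMap.sum_apply]
    exact Finset.sum_le_sum (hle p hp)

theorem IsFullPolytope.vertices_eq (hR : IsFullPolytope R) (hd : 0 < d) :
    vertices R = R.extremePoints ℝ := by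
  ext v
  constructor
  · intro hv
    exact isExtreme_singleton.1 (IsExposed.isExtreme hv)
  · intro hv
    exact hR.isFace_of_isExtreme hd (convex_singleton v) (isExtreme_singleton.2 hv)

theorem IsFullPolytope.finite_vertices (hR : IsFullPolytope R) : (vertices R).Finite :=
  Set.Finite.preimage (f := fun v : Euc d => ({v} : Set (Euc d)))
    Set.singleton_injective.injOn hR.finite_faces

theorem vertices_subset : vertices R ⊆ R := fun v (hv : IsFace R {v}) => hv.subset rfl

theorem IsFullPolytope.convexHull_vertices (hR : IsFullPolytope R) (hd : 0 < d) :
    convexHull ℝ (vertices R) = R := by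
  have h := closure_convexHull_extremePoints hR.isCompact hR.convex
  rw [← hR.vertices_eq hd] at h
  rwa [(Set.Finite.isCompact_convexHull (𝕜 := ℝ) hR.finite_vertices).isClosed.closure_eq] at h

theorem IsFullPolytope.convexHull_inter_vertices (hR : IsFullPolytope R) (hd : 0 < d)
    (hE : IsFace R E) : convexHull ℝ (E ∩ vertices R) = E := by
  have h := hE
  rw [← hR.convexHull_vertices hd] at h
  exact h.eq_convexHull_inter.symm

theorem IsFullPolytope.face_subset_iff (hR : IsFullPolytope R) (hd : 0 < d)
    (hE : IsFace R E) (hC : Convex ℝ C) : E ⊆ C ↔ ∀ v ∈ vertices R, v ∈ E → v ∈ C := by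
  refine ⟨fun h v _ hv => h hv, fun h => ?_⟩
  rw [← hR.convexHull_inter_vertices hd hE]
  exact convexHull_min (fun v hv => h v hv.2 hv.1) hC

theorem IsFullPolytope.exists_vertex_mem (hR : IsFullPolytope R) (hd : 0 < d)
    (hE : IsFace R E) (hne : E.Nonempty) : ∃ v ∈ vertices R, v ∈ E := by
  rw [← hR.convexHull_inter_vertices hd hE, convexHull_nonempty_iff] at hne
  obtain ⟨v, hv⟩ := hne
  exact ⟨v, hv.2, hv.1⟩

theorem IsFullPolytope.vertices_face (hR : IsFullPolytope R) (hd : 0 < d) (hE : IsFace R E) :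
    vertices E = vertices R ∩ E := by
  ext v
  constructor
  · intro hv
    refine ⟨?_, vertices_subset hv⟩
    rw [hR.vertices_eq hd, ← isExtreme_singleton]
    exact hE.isExtreme.trans (IsExposed.isExtreme hv)
  · rintro ⟨hv, hvE⟩
    exact IsExposed.mono hv hE.subset (singleton_subset_iff.2 hvE)

theorem IsFullPolytope.mem_of_mem_convexHull (hR : IsFullPolytope R) (hd : 0 < d)
    {A : Set (Euc d)} (hA : A ⊆ R) {v : Euc d} (hv : v ∈ vertices R)
    (hvA : v ∈ convexHull ℝ A) : v ∈ A := by
  rw [hR.vertices_eq hd] at hv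
  have hsub : convexHull ℝ A ⊆ R := convexHull_min hA hR.convex
  exact extremePoints_convexHull_subset
    (inter_extremePoints_subset_extremePoints_of_subset hsub ⟨hvA, hv⟩)

/-- The facets are the maximal proper faces. -/
theorem IsFullPolytope.mem_facets_iff (hR : IsFullPolytope R) (hd : 0 < d) :
    F ∈ facets R ↔ IsFace R F ∧ F ≠ R ∧ ∀ F', IsFace R F' → F ⊆ F' → F' ≠ R → F' ⊆ F := by
  constructor
  · intro hF
    refine ⟨hF.1, ?_, fun F' hF' hsub hne => ?_⟩
    · rintro rfl
      have := hF.2.2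
      omega
    · obtain ⟨G, hG, hF'G⟩ := hR.exists_facet_supset hd hF' (hF.2.1.mono hsub) hne
      obtain ⟨l, c, hl⟩ := hR.exists_facetFunctionals
      intro p hp
      have hlG := hl G hG
      have hspan : affineSpan ℝ F = affineSpan ℝ G := by
        apply AffineSubspace.eq_of_direction_eq_of_nonempty_of_le
        · rw [direction_affineSpan, direction_affineSpan]
          apply Submodule.eq_of_le_of_finrank_eq (vectorSpan_mono ℝ (hsub.trans hF'G))
          have h1 := hF.2.2
          have h2 := hG.2.2
          unfold dim at h1 h2
          omega
        · exact (affineSpan_nonempty ℝ).2 hF.2.1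
        · exact affineSpan_mono ℝ (hsub.trans hF'G)
      refine ((hl F hF).mem_iff hF.1 hF.2.1).2 ⟨hF'.subset hp, ?_⟩
      rw [← (hl F hF).1, hspan]
      exact mem_affineSpan ℝ (hF'G hp)
  · rintro ⟨hF, hne, hmax⟩
    have hsup : ∃ G ∈ facets R, F ⊆ G := by
      rcases F.eq_empty_or_nonempty with rfl | hFne
      -- The empty face still needs a facet above it: a compact `R` is not the whole space when `d >
      -- 0`, so some point is beyond a facet.
      · obtain ⟨w, hw⟩ : ∃ w, w ∉ R := by
          by_contra! h
          have hcpt := hR.isCompact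
          rw [eq_univ_of_forall h] at hcpt
          have : Nontrivial (Euc d) := by
            have : Nonempty (Fin d) := ⟨⟨0, hd⟩⟩
            infer_instance
          exact noncompact_univ (Euc d) hcpt
        obtain ⟨G, hG, -⟩ := hR.exists_isBeyond hd hw
        exact ⟨G, hG, empty_subset _⟩
      · exact hR.exists_facet_supset hd hF hFne hne
    obtain ⟨G, hG, hFG⟩ := hsup
    have hGR : G ≠ R := by
      rintro rfl
      have := hG.2.2
      omega
    rwa [hFG.antisymm (hmax G hG.1 hFG hGR)]

/-- An isomorphism of face lattices induces a bijection of the vertices. -/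
theorem exists_isCombinatorialIso {e : ℕ} {R' : Set (Euc e)} (hR : IsFullPolytope R)
    (hR' : IsFullPolytope R') (hd : 0 < d) (he : 0 < e) (ψ : Face R ≃o Face R') :
    ∃ φ : Euc d → Euc e, IsCombinatorialIso R R' φ ∧
      ∀ (v) (hv : IsFace R {v}), (ψ ⟨{v}, hv⟩).1 = {φ v} := by
  classical
  have key : ∀ {a b : ℕ} {A : Set (Euc a)} {B : Set (Euc b)} (_ : IsFullPolytope A)
      (_ : IsFullPolytope B) (_ : 0 < b) (χ : Face A ≃o Face B) (v) (hv : IsFace A {v}),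
      ∃ q, (χ ⟨{v}, hv⟩).1 = {q} := by
    intro a b A B hA hB hb χ v hv
    have hne : ∀ {a b : ℕ} {A : Set (Euc a)} {B : Set (Euc b)} (χ : Face A ≃o Face B)
        (f : Face A), f.1.Nonempty → (χ f).1.Nonempty := by
      intro a b A B χ f hf
      by_contra h
      rw [not_nonempty_iff_eq_empty] at h
      have h1 : χ f ≤ χ ⟨∅, isExposed_empty⟩ := by
        change (χ f).1 ⊆ _
        rw [h]
        exact empty_subset _
      have h2 : f.1 ⊆ ∅ := χ.le_iff_le.1 h1
      exact (hf.mono h2).ne_empty rfl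
    obtain ⟨q, hq, hqf⟩ := hB.exists_vertex_mem hb (χ ⟨{v}, hv⟩).2
      (hne χ _ (singleton_nonempty v))
    refine ⟨q, ?_⟩
    -- Pulling a vertex of the image face back gives a nonempty face inside `{v}`, hence `{v}`
    -- itself.
    have h1 : (⟨{q}, hq⟩ : Face B) ≤ χ ⟨{v}, hv⟩ := singleton_subset_iff.2 hqf
    have h2 : χ.symm ⟨{q}, hq⟩ ≤ ⟨{v}, hv⟩ := by rwa [OrderIso.symm_apply_le]
    have h3 : (χ.symm ⟨{q}, hq⟩).1 = {v} :=
      (hne χ.symm _ (singleton_nonempty q)).subset_singleton_iff.1 h2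
    have h4 : χ.symm ⟨{q}, hq⟩ = ⟨{v}, hv⟩ := Subtype.ext h3
    rw [← h4, OrderIso.apply_symm_apply]
  choose f hf using key hR hR' he ψ
  choose g hg using key hR' hR hd ψ.symm
  let φ : Euc d → Euc e := fun v => if hv : IsFace R {v} then f v hv else 0
  have hφ : ∀ (v) (hv : IsFace R {v}), (ψ ⟨{v}, hv⟩).1 = {φ v} := by
    intro v hv
    simp only [φ, dif_pos hv]
    exact hf v hv
  have hφv : ∀ v ∈ vertices R, φ v ∈ vertices R' := by
    intro v hv
    change IsFace R' {φ v}
    rw [← hφ v hv]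
    exact (ψ _).2
  have hφ' : ∀ (v) (hv : IsFace R {v}), ψ ⟨{v}, hv⟩ = ⟨{φ v}, hφv v hv⟩ :=
    fun v hv => Subtype.ext (hφ v hv)
  have hinj : InjOn φ (vertices R) := by
    intro v hv w hw h
    have : ψ ⟨{v}, hv⟩ = ψ ⟨{w}, hw⟩ := Subtype.ext (by rw [hφ v hv, hφ w hw, h])
    exact singleton_injective (congrArg Subtype.val (ψ.injective this))
  have hsurj : ∀ q ∈ vertices R', ∃ v ∈ vertices R, φ v = q := by
    intro q hq
    have h1 : IsFace R {g q hq} := by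
      rw [← hg q hq]
      exact (ψ.symm _).2
    refine ⟨g q hq, h1, ?_⟩
    have h2 : ψ.symm ⟨{q}, hq⟩ = ⟨{g q hq}, h1⟩ := Subtype.ext (hg q hq)
    have h3 : ψ ⟨{g q hq}, h1⟩ = ⟨{q}, hq⟩ := by rw [← h2, OrderIso.apply_symm_apply]
    have h4 := hφ _ h1
    rw [h3] at h4
    exact singleton_injective h4.symm
  refine ⟨φ, ⟨⟨hφv, hinj, hsurj⟩, ψ, fun F => ?_⟩, hφ⟩
  have hmem : ∀ v ∈ vertices R, (φ v ∈ (ψ F).1 ↔ v ∈ F.1) := by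
    intro v hv
    rw [← singleton_subset_iff, ← singleton_subset_iff (s := F.1), ← hφ v hv]
    exact ψ.le_iff_le (x := ⟨{v}, hv⟩) (y := F)
  ext q
  constructor
  · rintro ⟨hqF, hq⟩
    obtain ⟨v, hv, rfl⟩ := hsurj q hq
    exact ⟨v, ⟨(hmem v hv).1 hqF, hv⟩, rfl⟩
  · rintro ⟨v, ⟨hvF, hv⟩, rfl⟩
    exact ⟨(hmem v hv).2 hvF, hφv v hv⟩

end Sewing

/-! ### Faces of a polytope enlarged by one point. -/

namespace Sewing
open Set Filter Topology

variable {d : ℕ} {R F E H : Set (Euc d)} {z : Euc d}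

theorem subset_sewn : R ⊆ sewn R z := (subset_insert z R).trans (subset_convexHull ℝ _)

theorem mem_sewn : z ∈ sewn R z := subset_convexHull ℝ _ (mem_insert z R)

theorem IsFullPolytope.sewn (hR : IsFullPolytope R) (z : Euc d) : IsFullPolytope (sewn R z) := by
  classical
  refine ⟨?_, ?_⟩
  · obtain ⟨s, hs⟩ := hR.1
    refine ⟨insert z s, ?_⟩
    rw [Finset.coe_insert]
    refine Subset.antisymm (convexHull_min (insert_subset ?_ ?_) (convex_convexHull ℝ _))
      (convexHull_mono (insert_subset_insert ?_))
    · exact subset_convexHull ℝ _ (mem_insert _ _)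
    · rw [hs]
      exact convexHull_mono (subset_insert _ _)
    · rw [hs]
      exact subset_convexHull ℝ _
  · rw [eq_top_iff, ← hR.2]
    exact affineSpan_mono ℝ subset_sewn

theorem le_on_sewn {l : Euc d →ₗ[ℝ] ℝ} {c : ℝ} (h : ∀ p ∈ R, l p ≤ c) (hz : l z ≤ c) :
    ∀ p ∈ sewn R z, l p ≤ c := fun _ hp =>
  convexHull_min (t := {p | l p ≤ c}) (insert_subset hz h) (convex_halfSpace_le l.isLinear c) hp

theorem IsFace.inter_of_sewn (hH : IsFace (sewn R z) H) : IsFace R (H ∩ R) := by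
  rcases H.eq_empty_or_nonempty with rfl | hne
  · rw [empty_inter]
    exact isExposed_empty
  obtain ⟨l, c, hle, heq⟩ := hH.exists_functional hne
  convert isFace_setOf (R := R) l c fun p hp => hle p (subset_sewn hp) using 1
  ext p
  rw [heq]
  exact ⟨fun h => ⟨h.2, h.1.2⟩, fun h => ⟨⟨subset_sewn h.1, h.2⟩, h.1⟩⟩

theorem IsFace.subset_iff_of_sewn (hH : IsFace (Sewing.sewn R z) H) {C : Set (Euc d)}
    (hC : Convex ℝ C) : H ⊆ C ↔ (z ∈ H → z ∈ C) ∧ H ∩ R ⊆ C := by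
  refine ⟨fun h => ⟨fun hz => h hz, inter_subset_left.trans h⟩, fun h => ?_⟩
  have heq := IsFace.eq_convexHull_inter (S := insert z R) hH
  rw [heq]
  refine convexHull_min ?_ hC
  rintro p ⟨hp, rfl | hpR⟩
  · exact h.1 hp
  · exact h.2 ⟨hp, hpR⟩

/-- A functional exposing a face, where the empty face is allowed. -/
theorem IsFace.exists_functional' (hE : IsFace R E) :
    ∃ (l : Euc d →ₗ[ℝ] ℝ) (c : ℝ), (∀ p ∈ R, l p ≤ c) ∧ E = {p ∈ R | l p = c} := by
  rcases E.eq_empty_or_nonempty with rfl | hne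
  · refine ⟨0, 1, fun p _ => by simp, ?_⟩
    ext p
    simp
  · exact hE.exists_functional hne

/-- The functional exposing a face may be tilted towards any facet that contains the face. -/
theorem setOf_add_smul_eq {l l' : Euc d →ₗ[ℝ] ℝ} {c c' t : ℝ} (h : ∀ p ∈ R, l p ≤ c)
    (h' : ∀ p ∈ R, l' p ≤ c') (heq : ∀ p ∈ R, l p = c → l' p = c') (ht : 0 ≤ t) :
    (∀ p ∈ R, (l + t • l') p ≤ c + t * c') ∧
      {p ∈ R | (l + t • l') p = c + t * c'} = {p ∈ R | l p = c} := by
  have h1 : ∀ p ∈ R, t * l' p ≤ t * c' := fun p hp => mul_le_mul_of_nonneg_left (h' p hp) ht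
  refine ⟨fun p hp => ?_, ?_⟩
  · simp only [LinearMap.add_apply, LinearMap.smul_apply, smul_eq_mul]
    linarith [h p hp, h1 p hp]
  · ext p
    simp only [LinearMap.add_apply, LinearMap.smul_apply, smul_eq_mul, mem_ofPred_eq]
    refine and_congr_right fun hp => ⟨fun hs => ?_, fun hs => ?_⟩
    · exact le_antisymm (h p hp) (by linarith [h1 p hp])
    · rw [hs, heq p hp hs]

theorem setOf_sewn_of_lt {l : Euc d →ₗ[ℝ] ℝ} {c : ℝ} (hR : Convex ℝ R) (h : ∀ p ∈ R, l p ≤ c)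
    (hz : l z < c) : {p ∈ sewn R z | l p = c} = {p ∈ R | l p = c} := by
  have hface := isFace_setOf l c (le_on_sewn h hz.le)
  ext p
  refine ⟨fun hp => ⟨?_, hp.2⟩, fun hp => ⟨subset_sewn hp.1, hp.2⟩⟩
  exact (hface.subset_iff_of_sewn hR).2 ⟨fun hz' => absurd hz'.2 hz.ne, inter_subset_right⟩ hp

/-- Adding a large multiple of the functional of `F` to one exposing `E` still exposes `E` and
pushes `z` strictly below the maximum. -/
theorem IsFullPolytope.isFace_sewn_of_isBeneath (hR : IsFullPolytope R) (hE : IsFace R E)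
    (hF : F ∈ facets R) (hEF : E ⊆ F) (hz : IsBeneath R F z) : IsFace (Sewing.sewn R z) E := by
  obtain ⟨l, c, hl⟩ := hR.exists_supports hF
  rw [isBeneath_iff hl hF] at hz
  obtain ⟨l₀, c₀, hle, heq⟩ := hE.exists_functional'
  have hpos : 0 < c - l z := sub_pos.2 hz
  set t : ℝ := (|l₀ z - c₀| + 1) / (c - l z) with ht
  have ht0 : 0 ≤ t := by positivity
  have htz : t * (c - l z) = |l₀ z - c₀| + 1 := div_mul_cancel₀ _ hpos.ne'
  have hsub : ∀ p ∈ R, l₀ p = c₀ → l p = c := fun p hp h =>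
    ((hl.mem_iff hF.1 hF.2.1).1 (hEF (by rw [heq]; exact ⟨hp, h⟩))).2
  obtain ⟨h1, h2⟩ := setOf_add_smul_eq hle hl.2 hsub ht0
  have hlt : (l₀ + t • l) z < c₀ + t * c := by
    simp only [LinearMap.add_apply, LinearMap.smul_apply, smul_eq_mul]
    linarith [le_abs_self (l₀ z - c₀)]
  rw [heq, ← h2, ← setOf_sewn_of_lt hR.convex h1 hlt]
  exact isFace_setOf _ _ (le_on_sewn h1 hlt.le)

/-- A functional exposing `E` can be tilted towards either facet, raising or lowering its value at
`z`. The right multiple makes `z` reach the maximum exactly, and then `[E, z]` is exposed. -/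
theorem IsFullPolytope.isFace_sewn_of_isBeyond_of_isBeneath (hR : IsFullPolytope R)
    (hE : IsFace R E) {F' : Set (Euc d)} (hF : F ∈ facets R) (hF' : F' ∈ facets R) (hEF : E ⊆ F)
    (hEF' : E ⊆ F') (hz : IsBeyond R F z) (hz' : IsBeneath R F' z) :
    IsFace (Sewing.sewn R z) (convexHull ℝ (insert z E)) ∧
      convexHull ℝ (insert z E) ∩ R = E := by
  obtain ⟨l₀, c₀, hle, heq⟩ := hE.exists_functional'
  obtain ⟨G, hG, hEG, l, c, t, hl, ht, htz⟩ : ∃ G ∈ facets R, E ⊆ G ∧ ∃ l c t,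
      Supports R G l c ∧ 0 ≤ t ∧ l₀ z - c₀ + t * (l z - c) = 0 := by
    obtain ⟨l, c, hl⟩ := hR.exists_supports hF
    obtain ⟨l', c', hl'⟩ := hR.exists_supports hF'
    rw [isBeyond_iff hl hF] at hz
    rw [isBeneath_iff hl' hF'] at hz'
    rcases le_total (l₀ z - c₀) 0 with h0 | h0
    · refine ⟨F, hF, hEF, l, c, -(l₀ z - c₀) / (l z - c), hl,
        div_nonneg (by linarith) (by linarith), ?_⟩
      rw [div_mul_cancel₀ _ (by linarith)]
      ring
    · refine ⟨F', hF', hEF', l', c', (l₀ z - c₀) / (c' - l' z), hl',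
        div_nonneg (by linarith) (by linarith), ?_⟩
      have : (l₀ z - c₀) / (c' - l' z) * (c' - l' z) = l₀ z - c₀ :=
        div_mul_cancel₀ _ (by linarith)
      linarith
  have hsub : ∀ p ∈ R, l₀ p = c₀ → l p = c := fun p hp h =>
    ((hl.mem_iff hG.1 hG.2.1).1 (hEG (by rw [heq]; exact ⟨hp, h⟩))).2
  obtain ⟨h1, h2⟩ := setOf_add_smul_eq hle hl.2 hsub ht
  have hlz : (l₀ + t • l) z = c₀ + t * c := by
    simp only [LinearMap.add_apply, LinearMap.smul_apply, smul_eq_mul]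
    linarith
  have hK := isFace_setOf _ _ (le_on_sewn h1 hlz.le)
  set K := {p ∈ Sewing.sewn R z | (l₀ + t • l) p = c₀ + t * c} with hKdef
  have hKR : K ∩ R = E := by
    rw [heq, ← h2]
    ext p
    exact ⟨fun h => ⟨h.2, h.1.2⟩, fun h => ⟨⟨subset_sewn h.1, h.2⟩, h.1⟩⟩
  have hzK : z ∈ K := ⟨mem_sewn, hlz⟩
  have hKeq : K = convexHull ℝ (insert z E) := by
    refine Subset.antisymm ?_ ?_
    · rw [hK.subset_iff_of_sewn (convex_convexHull ℝ _), hKR]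
      exact ⟨fun _ => subset_convexHull ℝ _ (mem_insert _ _),
        (subset_insert _ _).trans (subset_convexHull ℝ _)⟩
    · refine convexHull_min (insert_subset hzK ?_) (hK.convex (hR.sewn z).convex)
      rw [← hKR]
      exact inter_subset_left
  rw [← hKeq]
  exact ⟨hK, hKR⟩

/-- Otherwise `z` is beyond every facet containing `H`, so a generic point of `H` can be moved away
from `z` inside `R`. This increases the functional exposing `H`, which is impossible. -/
theorem IsFullPolytope.exists_isBeneath_of_notMem (hR : IsFullPolytope R) (hd : 0 < d)
    (hz : ∀ F ∈ facets R, IsBeyond R F z ∨ IsBeneath R F z) (hH : IsFace (Sewing.sewn R z) H)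
    (hne : H.Nonempty) (hzH : z ∉ H) : ∃ F ∈ facets R, H ⊆ F ∧ IsBeneath R F z := by
  by_contra! hcon
  obtain ⟨l, c, hl⟩ := hR.exists_facetFunctionals
  obtain ⟨l₀, c₀, hle, heq⟩ := hH.exists_functional hne
  have hHR : H ⊆ R :=
    (hH.subset_iff_of_sewn hR.convex).2 ⟨fun h => absurd h hzH, inter_subset_right⟩
  obtain ⟨e, he, heF⟩ :=
    hR.exists_mem_forall_facet (hH.convex (hR.sewn z).convex) hHR hne
  have he₀ : l₀ e = c₀ := by
    rw [heq] at he
    exact he.2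
  have hlt : l₀ z < c₀ := by
    refine lt_of_le_of_ne (hle z mem_sewn) fun h => hzH ?_
    rw [heq]
    exact ⟨mem_sewn, h⟩
  have hev := hR.eventually_add_smul_mem hd hl (u := e - z) (hHR he) fun F hF heF' => by
    have h1 := ((hl F hF).mem_iff hF.1 hF.2.1).1 heF'
    have h2 := (hz F hF).resolve_right (hcon F hF (heF F hF heF'))
    rw [isBeyond_iff (hl F hF) hF] at h2
    rw [map_sub]
    linarith [h1.2]
  obtain ⟨ε, hε, hmem⟩ := exists_pos_of_eventually hev
  have := hle _ (subset_sewn hmem)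
  simp only [map_add, map_smul, map_sub, smul_eq_mul, he₀] at this
  have := mul_pos hε (sub_pos.2 hlt)
  linarith

/-- The sign `σ` treats the beyond and beneath cases together, with values `1` and `-1`. If the
claim failed, a generic point `e` of the trace could move along `σ (z - e)` strictly inwards; the
functional exposing `H` is constant in that direction, leaving room for a small extra move that
raises it. -/
theorem IsFullPolytope.exists_sign_facet (hR : IsFullPolytope R) (hd : 0 < d)
    {l : Set (Euc d) → Euc d →ₗ[ℝ] ℝ} {c : Set (Euc d) → ℝ} (hl : FacetFunctionals R l c)
    (hH : IsFace (Sewing.sewn R z) H) (hzH : z ∈ H) (hHR : H ≠ Sewing.sewn R z)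
    (hne : (H ∩ R).Nonempty) (σ : ℝ) :
    ∃ F ∈ facets R, H ∩ R ⊆ F ∧ 0 ≤ σ * (l F z - c F) := by
  by_contra! hcon
  obtain ⟨l₀, c₀, hle, heq⟩ := hH.exists_functional ⟨z, hzH⟩
  have hval : ∀ p ∈ H, l₀ p = c₀ := fun p hp => by
    rw [heq] at hp
    exact hp.2
  obtain ⟨e, he, heF⟩ := hR.exists_mem_forall_facet
    ((hH.convex (hR.sewn z).convex).inter hR.convex) inter_subset_right hne
  obtain ⟨r, hr, hlr⟩ : ∃ r ∈ R, l₀ r < c₀ := by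
    by_contra! h
    refine hHR (hH.subset.antisymm (convexHull_min (insert_subset hzH fun p hp => ?_)
      (hH.convex (hR.sewn z).convex)))
    rw [heq]
    exact ⟨subset_sewn hp, le_antisymm (hle p (subset_sewn hp)) (h p hp)⟩
  have hvalF : ∀ F ∈ facets R, e ∈ F → l F e = c F := fun F hF heF' =>
    (((hl F hF).mem_iff hF.1 hF.2.1).1 heF').2
  have hev : ∀ᶠ t in 𝓝[>] (0 : ℝ), ∀ F ∈ facets R,
      e ∈ F → σ * (l F z - c F) + t * (c F - l F r) ≤ 0 := by
    rw [eventually_all_finite hR.finite_facets]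
    intro F hF
    by_cases heF' : e ∈ F
    · have h1 := hcon F hF (heF F hF heF')
      filter_upwards [eventually_add_mul_nonpos (b := c F - l F r) h1.le
        fun h => absurd h h1.ne] with t ht _ using ht
    · exact Eventually.of_forall fun t h => absurd h heF'
  obtain ⟨t, ht, hall⟩ := exists_pos_of_eventually hev
  -- The part `t (e - r)`, with `r` in `R` below the maximum, is what pushes the functional above
  -- it.
  have hev' := hR.eventually_add_smul_mem hd hl (u := σ • (z - e) + t • (e - r)) he.2
    fun F hF heF' => by
      have := hall F hF heF'
      simpa only [map_add, map_smul, map_sub, smul_eq_mul, hvalF F hF heF'] using this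
  obtain ⟨ε, hε, hmem⟩ := exists_pos_of_eventually hev'
  have := hle _ (subset_sewn hmem)
  simp only [map_add, map_smul, map_sub, smul_eq_mul, hval e he.1, hval z hzH, sub_self,
    mul_zero, zero_add] at this
  have := mul_pos hε (mul_pos ht (sub_pos.2 hlr))
  linarith

theorem IsFullPolytope.exists_isBeyond_and_isBeneath (hR : IsFullPolytope R) (hd : 0 < d)
    (hz : ∀ F ∈ facets R, IsBeyond R F z ∨ IsBeneath R F z) (hH : IsFace (Sewing.sewn R z) H)
    (hzH : z ∈ H) (hHR : H ≠ Sewing.sewn R z) (hne : (H ∩ R).Nonempty) :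
    (∃ F ∈ facets R, H ∩ R ⊆ F ∧ IsBeyond R F z) ∧
      ∃ F ∈ facets R, H ∩ R ⊆ F ∧ IsBeneath R F z := by
  obtain ⟨l, c, hl⟩ := hR.exists_facetFunctionals
  constructor
  · obtain ⟨F, hF, hsub, h⟩ := hR.exists_sign_facet hd hl hH hzH hHR hne 1
    refine ⟨F, hF, hsub, (hz F hF).resolve_right fun h' => ?_⟩
    rw [isBeneath_iff (hl F hF) hF] at h'
    linarith
  · obtain ⟨F, hF, hsub, h⟩ := hR.exists_sign_facet hd hl hH hzH hHR hne (-1)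
    refine ⟨F, hF, hsub, (hz F hF).resolve_left fun h' => ?_⟩
    rw [isBeyond_iff (hl F hF) hF] at h'
    linarith

theorem IsBeyond.notMem (h : IsBeyond R F z) : z ∉ R := by
  obtain ⟨l, c, -, hle, hz⟩ := h
  exact fun hzR => absurd (hle z hzR) (not_le.2 hz)

end Sewing

/-! ### Neighbourly polytopes of even dimension: general position and simplicial faces. -/

namespace Sewing
open Set

variable {d : ℕ} {R F E D : Set (Euc d)}

theorem isExposed_convexHull_sdiff_singleton
    (hD : AffineIndependent ℝ (Subtype.val : D → Euc d)) {v : Euc d} (hv : v ∈ D) :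
    IsExposed ℝ (convexHull ℝ D) (convexHull ℝ (D \ {v})) := by
  rcases (D \ {v}).eq_empty_or_nonempty with h | ⟨p₀, hp₀⟩
  · rw [h, convexHull_empty]
    exact isExposed_empty
  have hnot : v - p₀ ∉ vectorSpan ℝ (D \ {v}) := by
    have h1 := hD.notMem_affineSpan_sdiff ⟨v, hv⟩ univ
    have h2 : (Subtype.val : D → Euc d) '' (univ \ {⟨v, hv⟩}) = D \ {v} := by
      ext p
      simp
    rw [h2, ← AffineSubspace.vsub_right_mem_direction_iff_mem (mem_affineSpan ℝ hp₀),
      direction_affineSpan] at h1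
    exact h1
  obtain ⟨f, hf, hfmap⟩ := Submodule.exists_dual_map_eq_bot_of_notMem hnot inferInstance
  -- The factor fixes the sign: the difference of values at `v` and `p₀` is minus a nonzero square.
  set l : Euc d →ₗ[ℝ] ℝ := (-(f (v - p₀))) • f with hl
  have hlv : l v < l p₀ := by
    have h1 : l v - l p₀ = -(f (v - p₀) * f (v - p₀)) := by
      rw [← map_sub]
      simp only [hl, LinearMap.smul_apply, smul_eq_mul]
      ring
    have := mul_self_pos.2 hf
    linarith
  have hlD : ∀ p ∈ D, p ≠ v → l p = l p₀ := by
    intro p hp hpv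
    have h1 : f (p - p₀) = 0 := by
      have : f (p - p₀) ∈ Submodule.map f (vectorSpan ℝ (D \ {v})) :=
        Submodule.mem_map_of_mem (vsub_mem_vectorSpan ℝ ⟨hp, hpv⟩ hp₀)
      rwa [hfmap, Submodule.mem_bot] at this
    rw [← sub_eq_zero, ← map_sub]
    simp [hl, h1]
  have hle : ∀ p ∈ convexHull ℝ D, l p ≤ l p₀ := by
    have : D ⊆ {p | l p ≤ l p₀} := by
      intro p hp
      rcases eq_or_ne p v with rfl | hpv
      · exact hlv.le
      · exact (hlD p hp hpv).le
    exact fun p hp => convexHull_min this (convex_halfSpace_le l.isLinear _) hp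
  have hface := isFace_setOf l (l p₀) hle
  have heq := hface.eq_convexHull_inter
  have hset : {p ∈ convexHull ℝ D | l p = l p₀} ∩ D = D \ {v} := by
    ext p
    constructor
    · rintro ⟨⟨-, h⟩, hp⟩
      refine ⟨hp, ?_⟩
      rintro rfl
      exact hlv.ne h
    · rintro ⟨hp, hpv⟩
      exact ⟨⟨subset_convexHull ℝ _ hp, hlD p hp hpv⟩, hp⟩
  rw [hset] at heq
  rw [← heq]
  exact hface

/-- `F` is a simplex, so its vertices outside `A` can be deleted one at a time, each deletion
passing to an extreme subset. -/
theorem IsFullPolytope.isFace_convexHull_of_affineIndependent (hR : IsFullPolytope R)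
    (hd : 0 < d) (hF : IsFace R F)
    (hind : AffineIndependent ℝ (Subtype.val : ↥(F ∩ vertices R) → Euc d)) {A : Set (Euc d)}
    (hA : A ⊆ F ∩ vertices R) : IsFace R (convexHull ℝ A) := by
  classical
  have key : ∀ T : Finset (Euc d), IsExtreme ℝ R (convexHull ℝ ((F ∩ vertices R) \ T)) := by
    intro T
    induction T using Finset.induction_on with
    | empty =>
      rw [Finset.coe_empty, sdiff_empty, hR.convexHull_inter_vertices hd hF]
      exact hF.isExtreme
    | insert v T _ ih =>
      have hset : (F ∩ vertices R) \ ↑(insert v T) = ((F ∩ vertices R) \ T) \ {v} := by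
        ext p
        simp only [Finset.coe_insert, mem_sdiff, mem_insert_iff, mem_singleton_iff]
        tauto
      rw [hset]
      by_cases hv : v ∈ (F ∩ vertices R) \ T
      · exact ih.trans (isExposed_convexHull_sdiff_singleton (hind.mono sdiff_subset) hv).isExtreme
      · rwa [sdiff_singleton_eq_self hv]
  have hfin : ((F ∩ vertices R) \ A).Finite :=
    hR.finite_vertices.subset (sdiff_subset.trans inter_subset_right)
  have := key hfin.toFinset
  rw [Finite.coe_toFinset, sdiff_sdiff_cancel_left hA] at this
  exact hR.isFace_of_isExtreme hd (convex_convexHull ℝ A) this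

/-- Enlarge `X` to `m` vertices, avoiding some `b ∈ Y` of positive weight in the expression of `q`.
Their hull is a face containing `q`, so it contains `b`, although `b` is a vertex of `P` not among
them. -/
theorem not_inter_convexHull_of_isNeighbourly {m : ℕ} {P : Set (Euc (2 * m))} (hm : 0 < m)
    (hP : IsFullPolytope P) (hN : IsNeighbourly P) (hcard : m < (vertices P).ncard)
    {X Y : Finset (Euc (2 * m))} (hX : (X : Set (Euc (2 * m))) ⊆ vertices P)
    (hY : (Y : Set (Euc (2 * m))) ⊆ vertices P) (hXY : Disjoint X Y) (hXm : X.card ≤ m)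
    {q : Euc (2 * m)} (hqX : q ∈ convexHull ℝ (X : Set (Euc (2 * m))))
    (hqY : q ∈ convexHull ℝ (Y : Set (Euc (2 * m)))) : False := by
  classical
  obtain ⟨w, hw0, hw1, hwq⟩ := Finset.mem_convexHull'.1 hqY
  obtain ⟨b, hb, hwb⟩ : ∃ b ∈ Y, 0 < w b := by
    by_contra! h
    have := Finset.sum_nonpos h
    linarith
  set V := hP.finite_vertices.toFinset with hV
  have hVcard : V.card = (vertices P).ncard := (ncard_eq_toFinset_card _ _).symm
  have hbV : b ∈ V := by
    rw [hV, Finite.mem_toFinset]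
    exact hY hb
  have hXV : X ⊆ V.erase b := by
    intro a ha
    refine Finset.mem_erase.2 ⟨?_, by rw [hV, Finite.mem_toFinset]; exact hX ha⟩
    rintro rfl
    exact Finset.disjoint_left.1 hXY ha hb
  obtain ⟨A, hXA, hAV, hAcard⟩ := Finset.exists_subsuperset_card_eq hXV hXm
    (by rw [Finset.card_erase_of_mem hbV]; omega)
  have hAvert : (A : Set (Euc (2 * m))) ⊆ vertices P := by
    intro a ha
    have := Finset.mem_of_mem_erase (hAV ha)
    rwa [hV, Finite.mem_toFinset] at this
  have hface := (hN A hAvert (by omega)).1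
  have hqA : q ∈ convexHull ℝ (A : Set (Euc (2 * m))) :=
    convexHull_mono (by exact_mod_cast hXA) hqX
  obtain ⟨l, c, hle, heq⟩ := hface.exists_functional ⟨q, hqA⟩
  have hq : l q = c := by
    rw [heq] at hqA
    exact hqA.2
  have hlY : ∀ y ∈ Y, w y * l y ≤ w y * c := fun y hy =>
    mul_le_mul_of_nonneg_left (hle y (vertices_subset (hY hy))) (hw0 y hy)
  have hsum : ∑ y ∈ Y, w y * l y = ∑ y ∈ Y, w y * c := by
    rw [← Finset.sum_mul, hw1, one_mul, ← hq, ← hwq, map_sum]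
    simp
  have hlb := (Finset.sum_eq_sum_iff_of_le hlY).1 hsum b hb
  have hlb' : l b = c := mul_left_cancel₀ hwb.ne' hlb
  have hbA : b ∈ convexHull ℝ (A : Set (Euc (2 * m))) := by
    rw [heq]
    exact ⟨vertices_subset (hY hb), hlb'⟩
  have hbA' := hP.mem_of_mem_convexHull (by omega) (hAvert.trans vertices_subset) (hY hb) hbA
  exact (Finset.mem_erase.1 (hAV hbA')).1 rfl

/-- The vertices of a neighbourly polytope of even dimension are in general position. -/
theorem IsNeighbourly.affineIndependent {m : ℕ} {P : Set (Euc (2 * m))} (hm : 0 < m)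
    (hP : IsFullPolytope P) (hN : IsNeighbourly P) (hcard : m < (vertices P).ncard)
    {A : Finset (Euc (2 * m))} (hA : (A : Set (Euc (2 * m))) ⊆ vertices P)
    (hAcard : A.card ≤ 2 * m + 1) : AffineIndependent ℝ (Subtype.val : A → Euc (2 * m)) := by
  classical
  by_contra hcon
  -- One part of a Radon partition of at most `2 * m + 1` points has at most `m` members.
  obtain ⟨I, q, hq, hq'⟩ := Convex.radon_partition hcon
  set X : Finset (Euc (2 * m)) := (Finset.univ.filter (· ∈ I)).map (Function.Embedding.subtype _)
    with hXdef
  set Y : Finset (Euc (2 * m)) := (Finset.univ.filter (· ∉ I)).map (Function.Embedding.subtype _)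
    with hYdef
  have hXc : (X : Set (Euc (2 * m))) = Subtype.val '' I := by
    ext p
    simp [hXdef]
  have hYc : (Y : Set (Euc (2 * m))) = Subtype.val '' Iᶜ := by
    ext p
    simp [hYdef]
  have hcards : X.card + Y.card = A.card := by
    rw [hXdef, hYdef, Finset.card_map, Finset.card_map,
      Finset.card_filter_add_card_filter_not, Finset.card_univ, Fintype.card_coe]
  have hdisj : Disjoint X Y := by
    rw [hXdef, hYdef, Finset.disjoint_map]
    exact Finset.disjoint_filter_filter_not _ _ _
  have hXV : (X : Set (Euc (2 * m))) ⊆ vertices P := by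
    rw [hXc]
    rintro _ ⟨p, -, rfl⟩
    exact hA p.2
  have hYV : (Y : Set (Euc (2 * m))) ⊆ vertices P := by
    rw [hYc]
    rintro _ ⟨p, -, rfl⟩
    exact hA p.2
  rw [← hXc] at hq
  rw [← hYc] at hq'
  rcases le_or_gt X.card m with h | h
  · exact not_inter_convexHull_of_isNeighbourly hm hP hN hcard hXV hYV hdisj h hq hq'
  · exact not_inter_convexHull_of_isNeighbourly hm hP hN hcard hYV hXV hdisj.symm (by omega) hq' hq

/-- Neighbourly polytopes of even dimension are simplicial. -/
theorem IsNeighbourly.isFace_convexHull {m : ℕ} {P : Set (Euc (2 * m))} (hm : 0 < m)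
    (hP : IsFullPolytope P) (hN : IsNeighbourly P) (hcard : m < (vertices P).ncard)
    {F A : Set (Euc (2 * m))} (hF : IsFace P F) (hFP : F ≠ P) (hA : A ⊆ F)
    (hAV : A ⊆ vertices P) : IsFace P (convexHull ℝ A) := by
  classical
  rcases F.eq_empty_or_nonempty with rfl | hne
  · rw [subset_empty_iff.1 hA, convexHull_empty]
    exact isExposed_empty
  refine hP.isFace_convexHull_of_affineIndependent (by omega) hF ?_ (subset_inter hA hAV)
  obtain ⟨l, c, hle, heq⟩ := hF.exists_functional hne
  have hl0 : l ≠ 0 := by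
    rintro rfl
    apply hFP
    obtain ⟨p, hp⟩ := hne
    rw [heq] at hp
    rw [heq]
    ext r
    exact ⟨fun h => h.1, fun h => ⟨h, by simpa using hp.2⟩⟩
  have hfin : (F ∩ vertices P).Finite := hP.finite_vertices.subset inter_subset_right
  set B := hfin.toFinset with hB
  have hBc : (B : Set (Euc (2 * m))) = F ∩ vertices P := hfin.coe_toFinset
  -- Were there more, `2 * m + 1` of them would be affinely independent and span the space, but they
  -- lie on the hyperplane supporting `F`.
  have hsmall : B.card ≤ 2 * m + 1 := by
    by_contra! hbig
    obtain ⟨T, hTB, hTcard⟩ := Finset.exists_subset_card_eq (n := 2 * m + 1) hbig.le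
    have hTsub : (T : Set (Euc (2 * m))) ⊆ F ∩ vertices P := by
      rw [← hBc]
      exact_mod_cast hTB
    have hT := IsNeighbourly.affineIndependent hm hP hN hcard (A := T)
      (hTsub.trans inter_subset_right) hTcard.le
    have h1 := hT.finrank_vectorSpan (n := 2 * m) (by rw [Fintype.card_coe, hTcard])
    have h2 : range (Subtype.val : T → Euc (2 * m)) = T := by simp
    rw [h2] at h1
    have h3 := dim_add_one_le (F := (T : Set (Euc (2 * m)))) hl0 (c := c) fun p hp => by
      have := (hTsub hp).1
      rw [heq] at this
      exact this.2
    unfold dim at h3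
    omega
  have := IsNeighbourly.affineIndependent hm hP hN hcard (A := B)
    (by rw [hBc]; exact inter_subset_right) hsmall
  have h2 : AffineIndependent ℝ (Subtype.val : ↥(B : Set (Euc (2 * m))) → Euc (2 * m)) := this
  rwa [hBc] at h2

end Sewing

/-! ### Levels of facets, and universal towers. -/

namespace Sewing
open Set

variable {d : ℕ} {R F : Set (Euc d)}

/-- `n` is the largest index of a member of the chain `Φ 1, …, Φ m` contained in `F`, or `0`. -/
def IsLevel (m : ℕ) (Φ : ℕ → Set (Euc d)) (F : Set (Euc d)) (n : ℕ) : Prop :=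
  n ≤ m ∧ ∀ j, 1 ≤ j → j ≤ m → (Φ j ⊆ F ↔ j ≤ n)

theorem exists_isLevel (m : ℕ) {Φ : ℕ → Set (Euc d)} (hΦ : ∀ j, Φ j ⊆ Φ (j + 1))
    (F : Set (Euc d)) : ∃ n, IsLevel m Φ F n := by
  have hmono : Monotone Φ := monotone_nat_of_le_succ hΦ
  induction m with
  | zero => exact ⟨0, le_rfl, fun j h1 h2 => by omega⟩
  | succ m ih =>
    obtain ⟨n, hn, h⟩ := ih
    by_cases hF : Φ (m + 1) ⊆ F
    · exact ⟨m + 1, le_rfl, fun j _ h2 => ⟨fun _ => h2, fun _ => (hmono h2).trans hF⟩⟩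
    · refine ⟨n, by omega, fun j h1 h2 => ?_⟩
      rcases h2.eq_or_lt with rfl | h3
      · exact ⟨fun h' => absurd h' hF, fun h' => by omega⟩
      · exact h j h1 (by omega)

/-- A facet of level `n` belongs to the nested families of index at most `n` only, so the one
difference of consecutive families containing it is the `n`-th. -/
theorem IsLevel.mem_beyondFacets_iff {m n : ℕ} {Φ : ℕ → Set (Euc d)} (h : IsLevel m Φ F n)
    (hF : F ∈ facets R) : F ∈ beyondFacets R m Φ ↔ Odd n := by
  obtain ⟨hn, hj⟩ := h
  simp only [beyondFacets, towerFacets, mem_iUnion, mem_sdiff, mem_ofPred_eq, hF, true_and]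
  constructor
  · rintro ⟨k, ⟨h1, h2⟩, h3⟩
    have h4 := (hj _ (by omega) h1).1 (h2 (by omega))
    refine ⟨k, le_antisymm ?_ h4⟩
    by_contra! h5
    exact h3 ⟨by omega, fun _ => (hj _ (by omega) (by omega)).2 (by omega)⟩
  · rintro ⟨k, rfl⟩
    refine ⟨k, ⟨hn, fun _ => (hj _ (by omega) hn).2 le_rfl⟩, ?_⟩
    rintro ⟨h1, h2⟩
    have := (hj _ (by omega) h1).1 (h2 (by omega))
    omega

theorem IsExactlyBeyond.isBeyond {m n : ℕ} {Φ : ℕ → Set (Euc d)} {z : Euc d}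
    (hz : IsExactlyBeyond R m Φ z) (hF : F ∈ facets R) (h : IsLevel m Φ F n) (hn : Odd n) :
    IsBeyond R F z :=
  hz.1 F ((h.mem_beyondFacets_iff hF).2 hn)

theorem IsExactlyBeyond.isBeneath {m n : ℕ} {Φ : ℕ → Set (Euc d)} {z : Euc d}
    (hz : IsExactlyBeyond R m Φ z) (hF : F ∈ facets R) (h : IsLevel m Φ F n) (hn : Even n) :
    IsBeneath R F z :=
  hz.2 F ⟨hF, fun h' => Nat.not_odd_iff_even.2 hn ((h.mem_beyondFacets_iff hF).1 h')⟩

theorem IsExactlyBeyond.isBeyond_or_isBeneath {m : ℕ} {Φ : ℕ → Set (Euc d)} {z : Euc d}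
    (hz : IsExactlyBeyond R m Φ z) (hF : F ∈ facets R) : IsBeyond R F z ∨ IsBeneath R F z := by
  by_cases h : F ∈ beyondFacets R m Φ
  · exact Or.inl (hz.1 F h)
  · exact Or.inr (hz.2 F ⟨hF, h⟩)

theorem IsBeyond.not_isBeneath {z : Euc d} (hF : F ∈ facets R) (h : IsBeyond R F z) :
    ¬ IsBeneath R F z := by
  obtain ⟨l, c, h1, h2, h3⟩ := h
  rw [isBeneath_iff (l := l) (c := c) ⟨h1, h2⟩ hF]
  exact h3.le.not_gt

theorem IsExactlyBeyond.odd_of_isBeyond {m n : ℕ} {Φ : ℕ → Set (Euc d)} {z : Euc d}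
    (hz : IsExactlyBeyond R m Φ z) (hF : F ∈ facets R) (h : IsLevel m Φ F n)
    (hb : IsBeyond R F z) : Odd n := by
  by_contra hn
  exact hb.not_isBeneath hF (hz.isBeneath hF h (Nat.not_odd_iff_even.1 hn))

theorem IsExactlyBeyond.even_of_isBeneath {m n : ℕ} {Φ : ℕ → Set (Euc d)} {z : Euc d}
    (hz : IsExactlyBeyond R m Φ z) (hF : F ∈ facets R) (h : IsLevel m Φ F n)
    (hb : IsBeneath R F z) : Even n := by
  by_contra hn
  exact (hz.isBeyond hF h (Nat.not_even_iff_odd.1 hn)).not_isBeneath hF hb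

section Tower

variable {x y : ℕ → Euc d}

theorem convex_towerFace (j : ℕ) : Convex ℝ (towerFace x y j) := by
  cases j with
  | zero => exact convex_empty
  | succ j => exact convex_convexHull ℝ _

theorem towerFace_subset_succ (j : ℕ) : towerFace x y j ⊆ towerFace x y (j + 1) :=
  subset_union_left.trans (subset_convexHull ℝ _)

theorem towerFace_mono {j k : ℕ} (h : j ≤ k) : towerFace x y j ⊆ towerFace x y k :=
  monotone_nat_of_le_succ (f := towerFace x y) towerFace_subset_succ h

theorem x_mem_towerFace {j k : ℕ} (hj : 1 ≤ j) (h : j ≤ k) : x j ∈ towerFace x y k := by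
  apply towerFace_mono h
  obtain ⟨j, rfl⟩ := Nat.exists_eq_add_of_le' hj
  exact subset_convexHull ℝ _ (Or.inr (Or.inl rfl))

theorem y_mem_towerFace {j k : ℕ} (hj : 1 ≤ j) (h : j ≤ k) : y j ∈ towerFace x y k := by
  apply towerFace_mono h
  obtain ⟨j, rfl⟩ := Nat.exists_eq_add_of_le' hj
  exact subset_convexHull ℝ _ (Or.inr (Or.inr rfl))

end Tower

namespace IsUniversalTower

variable {m : ℕ} {P : Set (Euc (2 * m))} {x y : ℕ → Euc (2 * m)}

theorem isFace (hT : IsUniversalTower P m x y) {j : ℕ} (hj : j ≤ m) :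
    IsFace P (towerFace x y j) := by
  rcases Nat.eq_zero_or_pos j with rfl | h
  · exact isExposed_empty
  · exact (hT.universal j ⟨h, hj⟩).1

theorem ne_self (hT : IsUniversalTower P m x y) (hP : IsFullPolytope P) {j : ℕ} (hj : j ≤ m) :
    towerFace x y j ≠ P := by
  rcases Nat.eq_zero_or_pos j with rfl | h
  · exact hP.nonempty.ne_empty.symm
  · intro h'
    have h1 := (hT.universal j ⟨h, hj⟩).2.2.1
    rw [h', hP.dim_eq] at h1
    omega

theorem mem_towerFace_iff (hT : IsUniversalTower P m x y) (hP : IsFullPolytope P) (hm : 0 < m)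
    {j : ℕ} (hj : j ≤ m) {v : Euc (2 * m)} (hv : v ∈ vertices P) :
    v ∈ towerFace x y j ↔ ∃ k ∈ Icc 1 j, v = x k ∨ v = y k := by
  constructor
  · induction j with
    | zero => exact fun h => h.elim
    | succ j ih =>
      intro h
      have hjm : j + 1 ∈ Icc 1 m := ⟨by omega, hj⟩
      have hsub : towerFace x y j ∪ {x (j + 1), y (j + 1)} ⊆ P := by
        refine union_subset (hT.isFace (by omega)).subset ?_
        rintro p (rfl | rfl)
        · exact vertices_subset (hT.x_mem _ hjm)
        · exact vertices_subset (hT.y_mem _ hjm)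
      rcases hP.mem_of_mem_convexHull (by omega) hsub hv h with h | rfl | rfl
      · obtain ⟨k, hk, hkv⟩ := ih (by omega) h
        exact ⟨k, ⟨hk.1, hk.2.trans (Nat.le_succ j)⟩, hkv⟩
      · exact ⟨j + 1, ⟨by omega, le_rfl⟩, Or.inl rfl⟩
      · exact ⟨j + 1, ⟨by omega, le_rfl⟩, Or.inr rfl⟩
  · rintro ⟨k, hk, rfl | rfl⟩
    · exact x_mem_towerFace hk.1 hk.2
    · exact y_mem_towerFace hk.1 hk.2

theorem x_notMem (hT : IsUniversalTower P m x y) (hP : IsFullPolytope P) {j k : ℕ}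
    (hjk : j < k) (hk : k ≤ m) : x k ∉ towerFace x y j := by
  intro h
  have hkm : k ∈ Icc 1 m := ⟨by omega, hk⟩
  obtain ⟨i, hi, h | h⟩ := (hT.mem_towerFace_iff hP (by omega) (by omega) (hT.x_mem k hkm)).1 h
  · have := hT.x_inj hkm ⟨hi.1, hi.2.trans (by omega)⟩ h
    have := hi.2
    omega
  · exact hT.x_ne_y k hkm i ⟨hi.1, hi.2.trans (by omega)⟩ h

theorem y_notMem (hT : IsUniversalTower P m x y) (hP : IsFullPolytope P) {j k : ℕ}
    (hjk : j < k) (hk : k ≤ m) : y k ∉ towerFace x y j := by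
  intro h
  have hkm : k ∈ Icc 1 m := ⟨by omega, hk⟩
  obtain ⟨i, hi, h | h⟩ := (hT.mem_towerFace_iff hP (by omega) (by omega) (hT.y_mem k hkm)).1 h
  · exact hT.x_ne_y i ⟨hi.1, hi.2.trans (by omega)⟩ k hkm h.symm
  · have := hT.y_inj hkm ⟨hi.1, hi.2.trans (by omega)⟩ h
    have := hi.2
    omega

/-- A face that contains `Φ_j` but misses a point of `Φ_{j+1}` lies in a facet with the same
properties. -/
theorem exists_facet_isLevel (hP : IsFullPolytope P) (hm : 0 < m)
    {E : Set (Euc (2 * m))} (hE : IsFace P E) (hne : E.Nonempty) {j : ℕ} (hj : j < m)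
    (hsub : towerFace x y j ⊆ E) {w : Euc (2 * m)} (hwP : w ∈ P) (hw : w ∈ towerFace x y (j + 1))
    (hwE : w ∉ E) : ∃ F ∈ facets P, E ⊆ F ∧ w ∉ F ∧ IsLevel m (towerFace x y) F j := by
  obtain ⟨F, hF, hEF, hwF⟩ := hP.exists_facet_notMem (by omega) hE hne hwP hwE
  refine ⟨F, hF, hEF, hwF, hj.le, fun k _ _ => ⟨fun h => ?_, fun h => ?_⟩⟩
  · by_contra! hlt
    exact hwF (h (towerFace_mono hlt hw))
  · exact (towerFace_mono h).trans (hsub.trans hEF)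

theorem exists_facet_isLevel_self (hT : IsUniversalTower P m x y) (hP : IsFullPolytope P) {j : ℕ}
    (hj : 1 ≤ j) (hjm : j ≤ m) :
    ∃ F ∈ facets P, towerFace x y j ⊆ F ∧ IsLevel m (towerFace x y) F j := by
  have hne : (towerFace x y j).Nonempty := ⟨x j, x_mem_towerFace hj le_rfl⟩
  rcases hjm.eq_or_lt with rfl | hlt
  · obtain ⟨F, hF, h⟩ := hP.exists_facet_supset (by omega) (hT.isFace le_rfl) hne
      (hT.ne_self hP le_rfl)
    exact ⟨F, hF, h, le_rfl, fun k _ hk => ⟨fun _ => hk, fun _ => (towerFace_mono hk).trans h⟩⟩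
  · obtain ⟨F, hF, h, -, hl⟩ := exists_facet_isLevel hP (by omega) (hT.isFace hjm) hne hlt
      Subset.rfl (vertices_subset (hT.x_mem (j + 1) ⟨by omega, hlt⟩))
      (x_mem_towerFace (by omega) le_rfl) (hT.x_notMem hP (Nat.lt_succ_self j) hlt)
    exact ⟨F, hF, h, hl⟩

end IsUniversalTower

end Sewing

/-! ### Quotient polytopes, and the face `[Φ_{i-1}, x_i, z]` of the sewn polytope. -/

namespace Sewing
open Set

variable {d e : ℕ} {P : Set (Euc d)} {G : Face P}

namespace QuotientPolytope

variable (Q : QuotientPolytope P G e)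

/-- The face of `P` that corresponds to a face of the quotient. -/
def lift (f : Face Q.carrier) : Set (Euc d) := (Q.faceIso f).1.1

theorem isFace_lift (f : Face Q.carrier) : IsFace P (Q.lift f) := (Q.faceIso f).1.2

theorem subset_lift (f : Face Q.carrier) : G.1 ⊆ Q.lift f := (Q.faceIso f).2

theorem lift_subset_lift {f g : Face Q.carrier} : Q.lift f ⊆ Q.lift g ↔ f.1 ⊆ g.1 :=
  Q.faceIso.le_iff_le (x := f) (y := g)

theorem lift_injective {f g : Face Q.carrier} (h : Q.lift f = Q.lift g) : f = g :=
  Q.faceIso.injective (Subtype.ext (Subtype.ext h))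

theorem exists_lift_eq {E : Set (Euc d)} (hE : IsFace P E) (hG : G.1 ⊆ E) :
    ∃ f, Q.lift f = E := by
  refine ⟨Q.faceIso.symm ⟨⟨E, hE⟩, hG⟩, ?_⟩
  unfold lift
  rw [OrderIso.apply_symm_apply]

theorem lift_self : Q.lift ⟨Q.carrier, IsExposed.refl _⟩ = P := by
  refine (Q.isFace_lift _).subset.antisymm ?_
  obtain ⟨f, hf⟩ := Q.exists_lift_eq (IsExposed.refl P) G.2.subset
  conv_lhs => rw [← hf]
  exact Q.lift_subset_lift.2 f.2.subset

theorem lift_empty : Q.lift ⟨∅, isExposed_empty⟩ = G.1 := by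
  refine Subset.antisymm ?_ (Q.subset_lift _)
  obtain ⟨f, hf⟩ := Q.exists_lift_eq G.2 Subset.rfl
  conv_rhs => rw [← hf]
  exact Q.lift_subset_lift.2 (empty_subset _)

theorem star_lift (f : Face Q.carrier) : Q.star (Q.lift f) = f.1 := by
  ext q
  constructor
  · rintro ⟨g, hg, hq⟩
    rwa [Q.lift_injective hg] at hq
  · exact fun hq => ⟨f, rfl, hq⟩

theorem lift_eq_self_iff {f : Face Q.carrier} : Q.lift f = P ↔ f.1 = Q.carrier := by
  constructor
  · intro h
    rw [Q.lift_injective (h.trans Q.lift_self.symm)]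
  · rintro h
    have : f = ⟨Q.carrier, IsExposed.refl _⟩ := Subtype.ext h
    rw [this, Q.lift_self]

/-- Facets are the maximal proper faces, a notion that an isomorphism with an interval up to `P`
preserves. -/
theorem lift_mem_facets_iff (hP : IsFullPolytope P) (hd : 0 < d) (he : 0 < e)
    {f : Face Q.carrier} : Q.lift f ∈ facets P ↔ f.1 ∈ facets Q.carrier := by
  rw [hP.mem_facets_iff hd, Q.isFullPolytope.mem_facets_iff he]
  constructor
  · rintro ⟨-, hne, hmax⟩
    refine ⟨f.2, fun h => hne (Q.lift_eq_self_iff.2 h), fun g hg hfg hgne => ?_⟩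
    exact Q.lift_subset_lift.1 (hmax (Q.lift ⟨g, hg⟩) (Q.isFace_lift _)
      (Q.lift_subset_lift.2 hfg) fun h => hgne (Q.lift_eq_self_iff.1 h))
  · rintro ⟨-, hne, hmax⟩
    refine ⟨Q.isFace_lift f, fun h => hne (Q.lift_eq_self_iff.1 h), fun E hE hfE hEne => ?_⟩
    obtain ⟨g, rfl⟩ := Q.exists_lift_eq hE ((Q.subset_lift f).trans hfE)
    exact Q.lift_subset_lift.2 (hmax g.1 g.2 (Q.lift_subset_lift.1 hfE)
      fun h => hEne (Q.lift_eq_self_iff.2 h))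

theorem isStarVertex_iff {v : Euc d} {p : Euc e} : Q.IsStarVertex v p ↔
    ∃ f : Face Q.carrier, f.1 = {p} ∧ v ∈ Q.lift f ∧
      ∀ E, IsFace P E → G.1 ⊆ E → v ∈ E → Q.lift f ⊆ E := by
  constructor
  · rintro ⟨f, hf, h1, h2⟩
    exact ⟨f, hf, h1.2, fun E hE hG hv => h2 (a := ⟨E, hE⟩) ⟨hG, hv⟩⟩
  · rintro ⟨f, hf, h1, h2⟩
    exact ⟨f, hf, ⟨Q.subset_lift f, h1⟩, fun E hE => h2 E.1 E.2 hE.1 hE.2⟩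

end QuotientPolytope

/-- The levels of a facet of `P` and of the corresponding facet of the quotient. -/
theorem IsLevel.quotient {m i n : ℕ} {Φ : ℕ → Set (Euc d)} (hi : 1 ≤ i) (him : i ≤ m)
    (hΦ : Monotone Φ) (hface : ∀ j ≤ m, IsFace P (Φ j)) {hG : IsFace P (Φ i)}
    (Q : QuotientPolytope P ⟨Φ i, hG⟩ e) {f : Face Q.carrier} (hn : IsLevel m Φ (Q.lift f) n) :
    i ≤ n ∧ IsLevel (m - i) (fun j => Q.star (Φ (i + j))) f.1 (n - i) := by
  have hin : i ≤ n := (hn.2 i hi him).1 (Q.subset_lift f)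
  refine ⟨hin, Nat.sub_le_sub_right hn.1 i, fun j hj hjm => ?_⟩
  obtain ⟨g, hg⟩ := Q.exists_lift_eq (hface (i + j) (by omega)) (hΦ (Nat.le_add_right i j))
  simp only
  rw [← hg, Q.star_lift, ← Q.lift_subset_lift, hg, hn.2 (i + j) (by omega) (by omega)]
  omega

/-- The trace on `R` of a face of the sewn polytope. -/
def Face.restrict {R : Set (Euc d)} {z : Euc d} (H : Face (sewn R z)) : Face R :=
  ⟨H.1 ∩ R, H.2.inter_of_sewn⟩

/-- Two order embeddings with the same range. Here `γ` will be the sets of vertices of `P`, and `f`,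
`g` the two codes. -/
theorem exists_orderIso_of_forall {α β γ : Type*} [PartialOrder α] [PartialOrder β]
    [PartialOrder γ] (f : α → γ) (g : β → γ) (hf : ∀ a b, f a ≤ f b ↔ a ≤ b)
    (hg : ∀ a b, g a ≤ g b ↔ a ≤ b) (h₁ : ∀ a, ∃ b, g b = f a) (h₂ : ∀ b, ∃ a, f a = g b) :
    ∃ Θ : α ≃o β, ∀ a, g (Θ a) = f a := by
  choose s hs using h₁
  choose t ht using h₂
  have hfi : ∀ {a b}, f a = f b → a = b := fun h =>
    le_antisymm ((hf _ _).1 h.le) ((hf _ _).1 h.ge)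
  have hgi : ∀ {a b}, g a = g b → a = b := fun h =>
    le_antisymm ((hg _ _).1 h.le) ((hg _ _).1 h.ge)
  refine ⟨⟨⟨s, t, fun a => hfi (by rw [ht, hs]), fun b => hgi (by rw [hs, ht])⟩, ?_⟩, hs⟩
  intro a b
  change s a ≤ s b ↔ a ≤ b
  rw [← hg, hs, hs, hf]

/-- The facet `[Φ_{i-1}, x_i]` of the simplex `Φ_i`. -/
def baseFace (x y : ℕ → Euc d) (i : ℕ) : Set (Euc d) :=
  convexHull ℝ (towerFace x y (i - 1) ∪ {x i})

theorem convexHull_union_pair_eq (x y : ℕ → Euc d) (i : ℕ) (z : Euc d) :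
    convexHull ℝ (towerFace x y (i - 1) ∪ {x i, z}) = convexHull ℝ (insert z (baseFace x y i)) := by
  apply Subset.antisymm
  · refine convexHull_mono ?_
    rintro p (hp | rfl | rfl)
    · exact Or.inr (subset_convexHull ℝ _ (Or.inl hp))
    · exact Or.inr (subset_convexHull ℝ _ (Or.inr rfl))
    · exact Or.inl rfl
  · refine convexHull_min (insert_subset (subset_convexHull ℝ _ (Or.inr (Or.inr rfl))) ?_)
      (convex_convexHull ℝ _)
    exact convexHull_mono (union_subset_union_right _ (singleton_subset_iff.2 (Or.inl rfl)))

/-- The situation of the sewing theorem. -/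
structure SewingData (m : ℕ) (P : Set (Euc (2 * m))) (x y : ℕ → Euc (2 * m))
    (z : Euc (2 * m)) : Prop where
  pos : 0 < m
  polytope : IsFullPolytope P
  neighbourly : IsNeighbourly P
  card : m < (vertices P).ncard
  tower : IsUniversalTower P m x y
  beyond : IsExactlyBeyond P m (towerFace x y) z

namespace SewingData

variable {m i : ℕ} {P : Set (Euc (2 * m))} {x y : ℕ → Euc (2 * m)} {z : Euc (2 * m)}

theorem two_mul_pos (h : SewingData m P x y z) : 0 < 2 * m := by
  have := h.pos
  omega

theorem mem_of_mem_convexHull (h : SewingData m P x y z) {A : Set (Euc (2 * m))}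
    (hA : A ⊆ vertices P) {v : Euc (2 * m)} (hv : v ∈ vertices P) :
    v ∈ convexHull ℝ A ↔ v ∈ A :=
  ⟨h.polytope.mem_of_mem_convexHull h.two_mul_pos (hA.trans vertices_subset) hv,
    fun hvA => subset_convexHull ℝ A hvA⟩

theorem isFace_convexHull (h : SewingData m P x y z) {F A : Set (Euc (2 * m))}
    (hF : IsFace P F) (hFP : F ≠ P) (hA : A ⊆ F) (hAV : A ⊆ vertices P) :
    IsFace P (convexHull ℝ A) :=
  h.neighbourly.isFace_convexHull h.pos h.polytope h.card hF hFP hA hAV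

theorem x_mem_baseFace : x i ∈ baseFace x y i := subset_convexHull ℝ _ (Or.inr rfl)

theorem towerFace_subset_baseFace : towerFace x y (i - 1) ⊆ baseFace x y i :=
  subset_union_left.trans (subset_convexHull ℝ _)

theorem baseFace_subset (hi : 1 ≤ i) : baseFace x y i ⊆ towerFace x y i := by
  refine convexHull_min (union_subset (towerFace_mono (Nat.sub_le i 1)) ?_) (convex_towerFace i)
  exact singleton_subset_iff.2 (x_mem_towerFace hi le_rfl)

theorem towerFace_subset_of_mem (hi : 1 ≤ i) {C : Set (Euc (2 * m))} (hC : Convex ℝ C)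
    (hb : baseFace x y i ⊆ C) (hy : y i ∈ C) : towerFace x y i ⊆ C := by
  obtain ⟨j, rfl⟩ := Nat.exists_eq_add_of_le' hi
  refine convexHull_min ?_ hC
  rintro p (hp | rfl | rfl)
  · exact hb (towerFace_subset_baseFace hp)
  · exact hb x_mem_baseFace
  · exact hy

theorem y_mem (h : SewingData m P x y z) (hi : 1 ≤ i) (him : i ≤ m) : y i ∈ vertices P :=
  h.tower.y_mem i ⟨hi, him⟩

theorem x_mem (h : SewingData m P x y z) (hi : 1 ≤ i) (him : i ≤ m) : x i ∈ vertices P :=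
  h.tower.x_mem i ⟨hi, him⟩

theorem mem_baseFace_iff (h : SewingData m P x y z) (hi : 1 ≤ i) (him : i ≤ m)
    {v : Euc (2 * m)} (hv : v ∈ vertices P) :
    v ∈ baseFace x y i ↔ v ∈ towerFace x y i ∧ v ≠ y i := by
  have hface := h.tower.isFace him
  constructor
  · refine fun hvb => ⟨baseFace_subset hi hvb, ?_⟩
    rintro rfl
    have hsub : towerFace x y (i - 1) ∪ {x i} ⊆ P :=
      ((subset_convexHull ℝ _).trans (baseFace_subset hi)).trans hface.subset
    rcases h.polytope.mem_of_mem_convexHull h.two_mul_pos hsub hv hvb with h' | h'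
    · exact h.tower.y_notMem h.polytope (by omega) him h'
    · exact h.tower.x_ne_y i ⟨hi, him⟩ i ⟨hi, him⟩ h'.symm
  · rintro ⟨hvi, hvy⟩
    obtain ⟨j, rfl⟩ := Nat.exists_eq_add_of_le' hi
    have hsub : towerFace x y j ∪ {x (j + 1), y (j + 1)} ⊆ P :=
      (subset_convexHull ℝ _).trans hface.subset
    rcases h.polytope.mem_of_mem_convexHull h.two_mul_pos hsub hv hvi with h' | rfl | rfl
    · exact towerFace_subset_baseFace h'
    · exact x_mem_baseFace
    · exact absurd rfl hvy

theorem baseFace_eq (h : SewingData m P x y z) (hi : 1 ≤ i) (him : i ≤ m) :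
    baseFace x y i = convexHull ℝ {v ∈ vertices P | v ∈ towerFace x y i ∧ v ≠ y i} := by
  apply Subset.antisymm
  · refine convexHull_min (union_subset ?_ ?_) (convex_convexHull ℝ _)
    · rw [h.polytope.face_subset_iff h.two_mul_pos (h.tower.isFace (by omega)) (convex_convexHull ℝ _)]
      intro v hv hvi
      refine subset_convexHull ℝ _ ⟨hv, ?_⟩
      exact (h.mem_baseFace_iff hi him hv).1 (towerFace_subset_baseFace hvi)
    · refine singleton_subset_iff.2 (subset_convexHull ℝ _ ⟨h.x_mem hi him, ?_⟩)
      exact (h.mem_baseFace_iff hi him (h.x_mem hi him)).1 x_mem_baseFace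
  · refine convexHull_min (fun v hv => ?_) (convex_convexHull ℝ _)
    exact (h.mem_baseFace_iff hi him hv.1).2 hv.2

theorem isFace_baseFace (h : SewingData m P x y z) (hi : 1 ≤ i) (him : i ≤ m) :
    IsFace P (baseFace x y i) := by
  rw [h.baseFace_eq hi him]
  exact h.isFace_convexHull (h.tower.isFace him) (h.tower.ne_self h.polytope him)
    (fun v hv => hv.2.1) fun v hv => hv.1

theorem y_notMem_baseFace (h : SewingData m P x y z) (hi : 1 ≤ i) (him : i ≤ m) :
    y i ∉ baseFace x y i := fun hy =>
  ((h.mem_baseFace_iff hi him (h.y_mem hi him)).1 hy).2 rfl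

/-- Levels of opposite parity mean that `z` is beyond one of the two facets and beneath the other;
which is which does not matter. -/
theorem isFace_sewn (h : SewingData m P x y z) {E F F' : Set (Euc (2 * m))} {n n' : ℕ}
    (hE : IsFace P E) (hF : F ∈ facets P) (hF' : F' ∈ facets P) (hEF : E ⊆ F) (hEF' : E ⊆ F')
    (hn : IsLevel m (towerFace x y) F n) (hn' : IsLevel m (towerFace x y) F' n')
    (hodd : Odd (n + n')) :
    IsFace (sewn P z) (convexHull ℝ (insert z E)) ∧ convexHull ℝ (insert z E) ∩ P = E := by
  rcases Nat.even_or_odd n with h1 | h1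
  · have h2 : Odd n' := (Nat.odd_add'.1 hodd).2 h1
    exact h.polytope.isFace_sewn_of_isBeyond_of_isBeneath hE hF' hF hEF' hEF
      (h.beyond.isBeyond hF' hn' h2) (h.beyond.isBeneath hF hn h1)
  · have h2 : Even n' := (Nat.odd_add.1 hodd).1 h1
    exact h.polytope.isFace_sewn_of_isBeyond_of_isBeneath hE hF hF' hEF hEF'
      (h.beyond.isBeyond hF hn h1) (h.beyond.isBeneath hF' hn' h2)

theorem exists_facet_isLevel_of_y_notMem (h : SewingData m P x y z) (hi : 1 ≤ i) (him : i ≤ m)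
    {E : Set (Euc (2 * m))} (hE : IsFace P E) (hb : baseFace x y i ⊆ E) (hy : y i ∉ E) :
    ∃ F ∈ facets P, E ⊆ F ∧ IsLevel m (towerFace x y) F (i - 1) := by
  obtain ⟨F, hF, hEF, -, hl⟩ := IsUniversalTower.exists_facet_isLevel (x := x) (y := y) h.polytope
    h.pos hE ⟨x i, hb x_mem_baseFace⟩ (j := i - 1) (by omega)
    (towerFace_subset_baseFace.trans hb) (vertices_subset (h.y_mem hi him))
    (y_mem_towerFace hi (by omega)) hy
  exact ⟨F, hF, hEF, hl⟩

/-- The consecutive levels `i - 1` (a facet missing `y i`) and `i` (a facet through `Φ_i`) both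
occur above the base face. -/
theorem isFace_sewn_baseFace (h : SewingData m P x y z) (hi : 1 ≤ i) (him : i ≤ m) :
    IsFace (sewn P z) (convexHull ℝ (insert z (baseFace x y i))) ∧
      convexHull ℝ (insert z (baseFace x y i)) ∩ P = baseFace x y i := by
  have hE := h.isFace_baseFace hi him
  obtain ⟨F, hF, hEF, hl⟩ :=
    h.exists_facet_isLevel_of_y_notMem hi him hE Subset.rfl (h.y_notMem_baseFace hi him)
  obtain ⟨F', hF', hEF', hl'⟩ := h.tower.exists_facet_isLevel_self h.polytope hi him
  refine h.isFace_sewn hE hF hF' hEF ((baseFace_subset hi).trans hEF') hl hl' ?_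
  exact ⟨i - 1, by omega⟩

theorem exists_isLevel_of_isFace_sewn (h : SewingData m P x y z) {K : Set (Euc (2 * m))}
    (hK : IsFace (sewn P z) K) (hzK : z ∈ K) (hKP : K ≠ sewn P z) (hne : (K ∩ P).Nonempty) :
    ∃ F ∈ facets P, ∃ F' ∈ facets P, ∃ n n', K ∩ P ⊆ F ∧ K ∩ P ⊆ F' ∧
      IsLevel m (towerFace x y) F n ∧ IsLevel m (towerFace x y) F' n' ∧ Odd n ∧ Even n' := by
  obtain ⟨⟨F, hF, hKF, hb⟩, F', hF', hKF', hb'⟩ := h.polytope.exists_isBeyond_and_isBeneath h.two_mul_pos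
    (fun F hF => h.beyond.isBeyond_or_isBeneath hF) hK hzK hKP hne
  obtain ⟨n, hn⟩ := exists_isLevel m (Φ := towerFace x y) towerFace_subset_succ F
  obtain ⟨n', hn'⟩ := exists_isLevel m (Φ := towerFace x y) towerFace_subset_succ F'
  exact ⟨F, hF, F', hF', n, n', hKF, hKF', hn, hn', h.beyond.odd_of_isBeyond hF hn hb,
    h.beyond.even_of_isBeneath hF' hn' hb'⟩

end SewingData

end Sewing

/-! ### The isomorphism between the sewn quotient and the quotient of the sewn polytope. -/

namespace Sewing
open Set SewingData

variable {m i e : ℕ} {P : Set (Euc (2 * m))} {x y : ℕ → Euc (2 * m)} {z : Euc (2 * m)}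

/-- A tower with a point sewn through it, and a point sewn onto a realization of the quotient by
a member of the tower other than the last. -/
structure QuotientSewing (m i e : ℕ) (P : Set (Euc (2 * m))) (x y : ℕ → Euc (2 * m))
    (z : Euc (2 * m)) (hG : IsFace P (towerFace x y i)) (Q : QuotientPolytope P ⟨_, hG⟩ e)
    (w : Euc e) : Prop extends SewingData m P x y z where
  one_le : 1 ≤ i
  lt : i < m
  dim_pos : 0 < e
  beyond_quotient :
    IsExactlyBeyond Q.carrier (m - i) (fun j => Q.star (towerFace x y (i + j))) w

/-- The vertices of `P` which determine the face `H` of the polytope sewn onto the quotient. -/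
def quotientCode (x y : ℕ → Euc (2 * m)) {G : Face P} (Q : QuotientPolytope P G e) (i : ℕ)
    (w : Euc e) (H : Face (sewn Q.carrier w)) : Set (Euc (2 * m)) :=
  {v ∈ vertices P | (v ∉ towerFace x y i ∧ v ∈ Q.lift H.restrict) ∨ (v = y i ∧ w ∈ H.1)}

/-- The vertices of `P` in `K` that are not in `[Φ_{i-1}, x_i]`. -/
def sewnCode (P : Set (Euc (2 * m))) (x y : ℕ → Euc (2 * m)) (i : ℕ) (K : Set (Euc (2 * m))) :
    Set (Euc (2 * m)) :=
  {v ∈ vertices P | v ∈ K ∧ v ∉ baseFace x y i}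

/-- A face of the sewn polytope is determined by its vertices in `P` and by whether it contains `z`;
since `K'` contains `z` and the base face, only the remaining vertices have to be compared. -/
theorem SewingData.sewnCode_le_iff (h : SewingData m P x y z) {K K' : Set (Euc (2 * m))}
    (hK : IsFace (sewn P z) K) (hK' : IsFace (sewn P z) K')
    (hb' : convexHull ℝ (insert z (baseFace x y i)) ⊆ K') :
    sewnCode P x y i K ⊆ sewnCode P x y i K' ↔ K ⊆ K' := by
  constructor
  · intro hsub
    have hconv := hK'.convex (h.polytope.sewn z).convex
    rw [hK.subset_iff_of_sewn hconv, h.polytope.face_subset_iff h.two_mul_pos hK.inter_of_sewn hconv]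
    refine ⟨fun _ => hb' (subset_convexHull ℝ _ (mem_insert _ _)), fun v hv hvK => ?_⟩
    by_cases hvb : v ∈ baseFace x y i
    · exact hb' (subset_convexHull ℝ _ (Or.inr hvb))
    · exact (hsub ⟨hv, hvK.1, hvb⟩).2.1
  · exact fun hsub v hv => ⟨hv.1, hsub hv.2.1, hv.2.2⟩

namespace QuotientSewing

variable {hG : IsFace P (towerFace x y i)} {Q : QuotientPolytope P ⟨_, hG⟩ e} {w : Euc e}

theorem y_mem_vertices (h : QuotientSewing m i e P x y z hG Q w) : y i ∈ vertices P :=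
  h.y_mem h.one_le h.lt.le

theorem y_mem_lift (h : QuotientSewing m i e P x y z hG Q w) (f : Face Q.carrier) :
    y i ∈ Q.lift f :=
  Q.subset_lift f (y_mem_towerFace h.one_le le_rfl)

theorem quotientCode_le_iff (h : QuotientSewing m i e P x y z hG Q w)
    (H H' : Face (sewn Q.carrier w)) :
    quotientCode x y Q i w H ⊆ quotientCode x y Q i w H' ↔ H ≤ H' := by
  constructor
  · intro hsub
    refine (H.2.subset_iff_of_sewn (H'.2.convex (Q.isFullPolytope.sewn w).convex)).2
      ⟨fun hw => ?_, ?_⟩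
    · rcases (hsub ⟨h.y_mem_vertices, Or.inr ⟨rfl, hw⟩⟩).2 with h' | h'
      · exact absurd (y_mem_towerFace h.one_le le_rfl) h'.1
      · exact h'.2
    · have : Q.lift H.restrict ⊆ Q.lift H'.restrict := by
        rw [h.polytope.face_subset_iff h.two_mul_pos (Q.isFace_lift _)
          ((Q.isFace_lift _).convex h.polytope.convex)]
        intro v hv hvl
        by_cases hvi : v ∈ towerFace x y i
        · exact Q.subset_lift _ hvi
        · rcases (hsub ⟨hv, Or.inl ⟨hvi, hvl⟩⟩).2 with h' | h'
          · exact h'.2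
          · rw [h'.1]
            exact h.y_mem_lift _
      exact (Q.lift_subset_lift.1 this).trans inter_subset_left
  · rintro hle v ⟨hv, h' | h'⟩
    · refine ⟨hv, Or.inl ⟨h'.1, ?_⟩⟩
      have : H.restrict.1 ⊆ H'.restrict.1 := inter_subset_inter_left _ hle
      exact Q.lift_subset_lift.2 this h'.2
    · exact ⟨hv, Or.inr ⟨h'.1, hle h'.2⟩⟩

theorem isLevel_sub (h : QuotientSewing m i e P x y z hG Q w) {f : Face Q.carrier} {n : ℕ}
    (hn : IsLevel m (towerFace x y) (Q.lift f) n) :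
    i ≤ n ∧ IsLevel (m - i) (fun j => Q.star (towerFace x y (i + j))) f.1 (n - i) :=
  hn.quotient h.one_le h.lt.le (fun _ _ => towerFace_mono) (fun _ hj => h.tower.isFace hj) Q

theorem exists_facet_lift (h : QuotientSewing m i e P x y z hG Q w) {F : Set (Euc (2 * m))} {n : ℕ}
    (hF : F ∈ facets P) (hsub : towerFace x y i ⊆ F) (hn : IsLevel m (towerFace x y) F n) :
    ∃ f : Face Q.carrier, Q.lift f = F ∧ f.1 ∈ facets Q.carrier ∧
      IsLevel (m - i) (fun j => Q.star (towerFace x y (i + j))) f.1 (n - i) := by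
  obtain ⟨f, rfl⟩ := Q.exists_lift_eq hF.1 hsub
  exact ⟨f, rfl, (Q.lift_mem_facets_iff h.polytope h.two_mul_pos h.dim_pos).1 hF, (h.isLevel_sub hn).2⟩

theorem exists_isLevel_lift (h : QuotientSewing m i e P x y z hG Q w) {F : Set (Euc e)}
    (hF : F ∈ facets Q.carrier) : ∃ n, Q.lift ⟨F, hF.1⟩ ∈ facets P ∧
      IsLevel m (towerFace x y) (Q.lift ⟨F, hF.1⟩) n ∧ i ≤ n ∧
      IsLevel (m - i) (fun j => Q.star (towerFace x y (i + j))) F (n - i) := by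
  obtain ⟨n, hn⟩ :=
    exists_isLevel m (Φ := towerFace x y) towerFace_subset_succ (Q.lift ⟨F, hF.1⟩)
  exact ⟨n, (Q.lift_mem_facets_iff h.polytope h.two_mul_pos h.dim_pos).2 hF, hn, h.isLevel_sub hn⟩

/-- The facets of the quotient beyond and beneath which the sewn point lies. -/
theorem exists_beyond_beneath (h : QuotientSewing m i e P x y z hG Q w) :
    (∃ F ∈ facets Q.carrier, IsBeyond Q.carrier F w) ∧
      ∃ F ∈ facets Q.carrier, IsBeneath Q.carrier F w := by
  constructor
  · obtain ⟨F, hF, hsub, hl⟩ := h.tower.exists_facet_isLevel_self h.polytope (j := i + 1)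
      (by omega) h.lt
    obtain ⟨f, -, hf, hfl⟩ := h.exists_facet_lift hF ((towerFace_subset_succ i).trans hsub) hl
    exact ⟨f.1, hf, h.beyond_quotient.isBeyond hf hfl (by simp)⟩
  · obtain ⟨F, hF, hsub, hl⟩ := h.tower.exists_facet_isLevel_self h.polytope h.one_le h.lt.le
    obtain ⟨f, -, hf, hfl⟩ := h.exists_facet_lift hF hsub hl
    exact ⟨f.1, hf, h.beyond_quotient.isBeneath hf hfl (by simp)⟩

theorem notMem_carrier (h : QuotientSewing m i e P x y z hG Q w) : w ∉ Q.carrier := by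
  obtain ⟨⟨F, -, hF⟩, -⟩ := h.exists_beyond_beneath
  exact hF.notMem

theorem lift_restrict_of_eq_empty {H : Face (sewn Q.carrier w)} (hH : H.1 ∩ Q.carrier = ∅) :
    Q.lift H.restrict = towerFace x y i := by
  have : H.restrict = ⟨∅, isExposed_empty⟩ := Subtype.ext hH
  rw [this, Q.lift_empty]

theorem exists_even_of_notMem (h : QuotientSewing m i e P x y z hG Q w)
    {H : Face (sewn Q.carrier w)} (hw : w ∉ H.1) : ∃ F ∈ facets P, Q.lift H.restrict ⊆ F ∧
      ∃ n, IsLevel m (towerFace x y) F n ∧ i ≤ n ∧ Even (n - i) := by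
  rcases H.1.eq_empty_or_nonempty with hemp | hne
  -- The empty face lifts to `Φ_i`, which lies in a facet of level `i`, with even difference `0`.
  · obtain ⟨F, hF, hsub, hl⟩ := h.tower.exists_facet_isLevel_self h.polytope h.one_le h.lt.le
    rw [lift_restrict_of_eq_empty (by rw [hemp, empty_inter])]
    exact ⟨F, hF, hsub, i, hl, le_rfl, by simp⟩
  · obtain ⟨F, hF, hsub, hb⟩ := Q.isFullPolytope.exists_isBeneath_of_notMem h.dim_pos
      (fun F hF => h.beyond_quotient.isBeyond_or_isBeneath hF) H.2 hne hw
    obtain ⟨n, hF', hn, hin, hl⟩ := h.exists_isLevel_lift hF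
    refine ⟨_, hF', Q.lift_subset_lift.2 (inter_subset_left.trans hsub), n, hn, hin, ?_⟩
    exact h.beyond_quotient.even_of_isBeneath hF hl hb

theorem exists_odd_even_of_mem (h : QuotientSewing m i e P x y z hG Q w)
    {H : Face (sewn Q.carrier w)} (hw : w ∈ H.1) (hH : H.1 ≠ sewn Q.carrier w) :
    ∃ F ∈ facets P, ∃ F' ∈ facets P, Q.lift H.restrict ⊆ F ∧ Q.lift H.restrict ⊆ F' ∧
      ∃ n n', IsLevel m (towerFace x y) F n ∧ IsLevel m (towerFace x y) F' n' ∧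
        Odd (n + n') := by
  rcases (H.1 ∩ Q.carrier).eq_empty_or_nonempty with hemp | hne
  -- With empty trace the lift is again `Φ_i`; the facets of levels `i` and `i + 1` above it supply
  -- both parities. The latter exists because `i < m`.
  · obtain ⟨F, hF, hsub, hl⟩ := h.tower.exists_facet_isLevel_self h.polytope h.one_le h.lt.le
    obtain ⟨F', hF', hsub', hl'⟩ := h.tower.exists_facet_isLevel_self h.polytope (j := i + 1)
      (by omega) h.lt
    rw [lift_restrict_of_eq_empty hemp]
    exact ⟨F, hF, F', hF', hsub, (towerFace_subset_succ i).trans hsub', i, i + 1, hl, hl',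
      i, by omega⟩
  · obtain ⟨⟨F, hF, hsub, hb⟩, F', hF', hsub', hb'⟩ :=
      Q.isFullPolytope.exists_isBeyond_and_isBeneath h.dim_pos
        (fun F hF => h.beyond_quotient.isBeyond_or_isBeneath hF) H.2 hw hH hne
    obtain ⟨n, hFP, hn, hin, hl⟩ := h.exists_isLevel_lift hF
    obtain ⟨n', hFP', hn', hin', hl'⟩ := h.exists_isLevel_lift hF'
    refine ⟨_, hFP, _, hFP', Q.lift_subset_lift.2 hsub, Q.lift_subset_lift.2 hsub', n, n', hn, hn',
      ?_⟩
    obtain ⟨a, ha⟩ := h.beyond_quotient.odd_of_isBeyond hF hl hb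
    obtain ⟨b, hb⟩ := h.beyond_quotient.even_of_isBeneath hF' hl' hb'
    exact ⟨a + b + i, by omega⟩

theorem exists_sewnCode_eq (h : QuotientSewing m i e P x y z hG Q w)
    (H : Face (sewn Q.carrier w)) : ∃ K, IsFace (sewn P z) K ∧
      convexHull ℝ (insert z (baseFace x y i)) ⊆ K ∧
      sewnCode P x y i K = quotientCode x y Q i w H := by
  have hi := h.one_le
  have him := h.lt.le
  have hsubE : ∀ f, baseFace x y i ⊆ Q.lift f := fun f =>
    (baseFace_subset hi).trans (Q.subset_lift f)
  -- the code of a face that contains the sewn point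
  have hcode : w ∈ H.1 → ∀ K, K ∩ P = Q.lift H.restrict →
      sewnCode P x y i K = quotientCode x y Q i w H := by
    intro hw K hKP
    ext v
    refine and_congr_right fun hv => ?_
    have hvK : v ∈ K ↔ v ∈ Q.lift H.restrict := by
      rw [← hKP]
      exact ⟨fun hvK => ⟨hvK, vertices_subset hv⟩, fun hvK => hvK.1⟩
    rw [hvK, h.mem_baseFace_iff hi him hv]
    have h1 : v ∈ towerFace x y i → v ∈ Q.lift H.restrict := fun h' => Q.subset_lift _ h'
    have h2 : v = y i → v ∈ towerFace x y i := by
      rintro rfl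
      exact y_mem_towerFace hi le_rfl
    tauto
  by_cases hH : H.1 = sewn Q.carrier w
  · refine ⟨sewn P z, IsExposed.refl _, (h.isFace_sewn_baseFace hi him).1.subset,
      hcode (by rw [hH]; exact mem_sewn) _ ?_⟩
    have hr : H.restrict = ⟨Q.carrier, IsExposed.refl _⟩ := by
      apply Subtype.ext
      change H.1 ∩ Q.carrier = Q.carrier
      rw [hH, inter_eq_right]
      exact subset_sewn
    rw [hr, Q.lift_self, inter_eq_right]
    exact subset_sewn
  by_cases hw : w ∈ H.1
  · obtain ⟨F, hF, F', hF', hsub, hsub', n, n', hn, hn', hodd⟩ := h.exists_odd_even_of_mem hw hH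
    obtain ⟨hK, hKP⟩ := h.isFace_sewn (Q.isFace_lift _) hF hF' hsub hsub' hn hn' hodd
    exact ⟨_, hK, convexHull_mono (insert_subset_insert (hsubE _)), hcode hw _ hKP⟩
  · obtain ⟨F, hF, hsub, n, hn, hin, heven⟩ := h.exists_even_of_notMem hw
    -- A face without `w` must go to one without `y i`, so `y i` is removed from the lift;
    -- simpliciality keeps the rest a face. Missing `y i` yields a facet of level `i - 1`, of parity
    -- opposite to `n`.
    set A : Set (Euc (2 * m)) := {v ∈ vertices P | v ∈ Q.lift H.restrict ∧ v ≠ y i} with hA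
    have hAV : A ⊆ vertices P := fun v hv => hv.1
    have hAF : A ⊆ F := fun v hv => hsub hv.2.1
    have hFP : F ≠ P := ((h.polytope.mem_facets_iff h.two_mul_pos).1 hF).2.1
    have hE := h.isFace_convexHull hF.1 hFP hAF hAV
    have hbE : baseFace x y i ⊆ convexHull ℝ A := by
      rw [h.baseFace_eq hi him]
      exact convexHull_mono fun v hv => ⟨hv.1, Q.subset_lift _ hv.2.1, hv.2.2⟩
    have hyE : y i ∉ convexHull ℝ A := fun hy =>
      ((h.mem_of_mem_convexHull hAV h.y_mem_vertices).1 hy).2.2 rfl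
    obtain ⟨F', hF', hsub', hn'⟩ := h.exists_facet_isLevel_of_y_notMem hi him hE hbE hyE
    obtain ⟨hK, hKP⟩ := h.isFace_sewn hE hF hF'
      (convexHull_min hAF (hF.1.convex h.polytope.convex)) hsub' hn hn' (by
        obtain ⟨a, ha⟩ := heven
        exact ⟨a + (i - 1), by omega⟩)
    refine ⟨_, hK, convexHull_mono (insert_subset_insert hbE), ?_⟩
    ext v
    refine and_congr_right fun hv => ?_
    have hvK : v ∈ convexHull ℝ (insert z (convexHull ℝ A)) ↔ v ∈ A := by
      rw [← h.mem_of_mem_convexHull hAV hv]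
      refine ⟨fun hvK => ?_, fun hvA => subset_convexHull ℝ _ (Or.inr hvA)⟩
      rw [← hKP]
      exact ⟨hvK, vertices_subset hv⟩
    rw [hvK, h.mem_baseFace_iff hi him hv]
    have h1 : v = y i → v ∈ towerFace x y i := by
      rintro rfl
      exact y_mem_towerFace hi le_rfl
    simp only [hA, mem_ofPred_eq]
    tauto

theorem exists_quotientCode_eq (h : QuotientSewing m i e P x y z hG Q w) {K : Set (Euc (2 * m))}
    (hK : IsFace (sewn P z) K) (hbK : convexHull ℝ (insert z (baseFace x y i)) ⊆ K) :
    ∃ H : Face (sewn Q.carrier w), quotientCode x y Q i w H = sewnCode P x y i K := by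
  have hi := h.one_le
  have him := h.lt.le
  have hbase : baseFace x y i ⊆ K :=
    ((subset_insert _ _).trans (subset_convexHull ℝ _)).trans hbK
  have hbaseP : baseFace x y i ⊆ P := (h.isFace_baseFace hi him).subset
  have hyP := vertices_subset h.y_mem_vertices
  have hconv : Convex ℝ (K ∩ P) := hK.inter_of_sewn.convex h.polytope.convex
  have hmem : ∀ v ∈ vertices P, (v ∈ K ↔ v ∈ K ∩ P) := fun v hv =>
    ⟨fun hvK => ⟨hvK, vertices_subset hv⟩, fun hvK => hvK.1⟩
  have hyi : ∀ v, v = y i → v ∈ towerFace x y i := by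
    rintro v rfl
    exact y_mem_towerFace hi le_rfl
  by_cases hyK : y i ∈ K
  · have hΦ : towerFace x y i ⊆ K ∩ P :=
      towerFace_subset_of_mem hi hconv (subset_inter hbase hbaseP) ⟨hyK, hyP⟩
    -- the code of a face that contains the sewn point and has the right trace
    have hcode : ∀ H : Face (sewn Q.carrier w), w ∈ H.1 → Q.lift H.restrict = K ∩ P →
        quotientCode x y Q i w H = sewnCode P x y i K := by
      intro H hw hH
      ext v
      refine and_congr_right fun hv => ?_
      rw [hH, hmem v hv, h.mem_baseFace_iff hi him hv]
      have h1 : v ∈ towerFace x y i → v ∈ K ∩ P := fun h' => hΦ h'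
      have h2 := hyi v
      tauto
    by_cases hKP : K = sewn P z
    · refine ⟨⟨sewn Q.carrier w, IsExposed.refl _⟩, hcode _ mem_sewn ?_⟩
      have hr : Face.restrict ⟨sewn Q.carrier w, IsExposed.refl _⟩ =
          (⟨Q.carrier, IsExposed.refl _⟩ : Face Q.carrier) := by
        apply Subtype.ext
        change sewn Q.carrier w ∩ Q.carrier = Q.carrier
        rw [inter_eq_right]
        exact subset_sewn
      rw [hr, Q.lift_self, hKP, eq_comm, inter_eq_right]
      exact subset_sewn
    obtain ⟨F, hF, F', hF', n, n', hsub, hsub', hn, hn', hodd, heven⟩ :=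
      h.exists_isLevel_of_isFace_sewn hK (hbK (subset_convexHull ℝ _ (mem_insert _ _))) hKP
        ⟨y i, hyK, hyP⟩
    obtain ⟨f, hf, hff, hfl⟩ := h.exists_facet_lift hF (hΦ.trans hsub) hn
    obtain ⟨f', hf', hff', hfl'⟩ := h.exists_facet_lift hF' (hΦ.trans hsub') hn'
    obtain ⟨g, hg⟩ := Q.exists_lift_eq hK.inter_of_sewn hΦ
    have hgf : g.1 ⊆ f.1 := by rwa [← Q.lift_subset_lift, hg, hf]
    have hgf' : g.1 ⊆ f'.1 := by rwa [← Q.lift_subset_lift, hg, hf']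
    have hin : i ≤ n := (hn.2 i hi him).1 (hΦ.trans hsub)
    have hin' : i ≤ n' := (hn'.2 i hi him).1 (hΦ.trans hsub')
    obtain ⟨a, ha⟩ := hodd
    obtain ⟨b, hb⟩ := heven
    -- Passing to the quotient subtracts `i` from both levels. For odd `i` the beyond and beneath
    -- facets exchange roles, but both kinds remain.
    have hH : IsFace (sewn Q.carrier w) (convexHull ℝ (insert w g.1)) ∧
        convexHull ℝ (insert w g.1) ∩ Q.carrier = g.1 := by
      rcases Nat.even_or_odd i with ⟨c, hc⟩ | ⟨c, hc⟩
      · exact Q.isFullPolytope.isFace_sewn_of_isBeyond_of_isBeneath g.2 hff hff' hgf hgf'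
          (h.beyond_quotient.isBeyond hff hfl ⟨a - c, by omega⟩)
          (h.beyond_quotient.isBeneath hff' hfl' ⟨b - c, by omega⟩)
      · exact Q.isFullPolytope.isFace_sewn_of_isBeyond_of_isBeneath g.2 hff' hff hgf' hgf
          (h.beyond_quotient.isBeyond hff' hfl' ⟨b - c - 1, by omega⟩)
          (h.beyond_quotient.isBeneath hff hfl ⟨a - c, by omega⟩)
    refine ⟨⟨_, hH.1⟩, hcode _ (subset_convexHull ℝ _ (mem_insert _ _)) ?_⟩
    have hr : Face.restrict ⟨_, hH.1⟩ = g := Subtype.ext hH.2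
    rw [hr, hg]
  · have hKP : K ≠ sewn P z := fun h' => hyK (h' ▸ subset_sewn hyP)
    obtain ⟨F₁, hF₁, F₂, hF₂, n₁, n₂, hsub₁, hsub₂, hn₁, hn₂, hodd, heven⟩ :=
      h.exists_isLevel_of_isFace_sewn hK (hbK (subset_convexHull ℝ _ (mem_insert _ _))) hKP
        ⟨x i, hbase x_mem_baseFace, hbaseP x_mem_baseFace⟩
    have hlow : ∀ {F n}, K ∩ P ⊆ F → IsLevel m (towerFace x y) F n → i - 1 ≤ n := by
      intro F n hsub hn
      rcases Nat.eq_zero_or_pos (i - 1) with h0 | h0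
      · omega
      · refine (hn.2 (i - 1) h0 (by omega)).1 ?_
        exact towerFace_subset_baseFace.trans ((subset_inter hbase hbaseP).trans hsub)
    have hlow₁ := hlow hsub₁ hn₁
    have hlow₂ := hlow hsub₂ hn₂
    obtain ⟨a, ha⟩ := hodd
    obtain ⟨b, hb⟩ := heven
    -- Of the two facets, take the one whose level has the parity of `i`. That level is at least `i
    -- - 1` and differs from it in parity, hence is at least `i`.
    obtain ⟨F, hF, n, hsub, hn, hin, hpar⟩ : ∃ F ∈ facets P, ∃ n, K ∩ P ⊆ F ∧
        IsLevel m (towerFace x y) F n ∧ i ≤ n ∧ Even (n - i) := by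
      rcases Nat.even_or_odd i with ⟨c, hc⟩ | ⟨c, hc⟩
      · exact ⟨F₂, hF₂, n₂, hsub₂, hn₂, by omega, b - c, by omega⟩
      · exact ⟨F₁, hF₁, n₁, hsub₁, hn₁, by omega, a - c, by omega⟩
    have hΦF : towerFace x y i ⊆ F := (hn.2 i hi him).2 hin
    -- Adding `y i` stays inside the facet `F`, so the hull is a face by simpliciality. It contains
    -- `Φ_i`, and its image in the quotient lies in a facet beneath which `w` lies.
    set A : Set (Euc (2 * m)) := {v ∈ vertices P | v ∈ K ∨ v = y i} with hA
    have hAV : A ⊆ vertices P := fun v hv => hv.1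
    have hAF : A ⊆ F := by
      rintro v ⟨hv, hvK | rfl⟩
      · exact hsub ⟨hvK, vertices_subset hv⟩
      · exact hΦF (y_mem_towerFace hi le_rfl)
    have hFP : F ≠ P := ((h.polytope.mem_facets_iff h.two_mul_pos).1 hF).2.1
    have hE := h.isFace_convexHull hF.1 hFP hAF hAV
    have hΦE : towerFace x y i ⊆ convexHull ℝ A := by
      refine towerFace_subset_of_mem hi (convex_convexHull ℝ _) ?_
        (subset_convexHull ℝ _ ⟨h.y_mem_vertices, Or.inr rfl⟩)
      rw [h.polytope.face_subset_iff h.two_mul_pos (h.isFace_baseFace hi him) (convex_convexHull ℝ _)]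
      exact fun v hv hvb => subset_convexHull ℝ _ ⟨hv, Or.inl (hbase hvb)⟩
    obtain ⟨f, hf, hff, hfl⟩ := h.exists_facet_lift hF hΦF hn
    obtain ⟨g, hg⟩ := Q.exists_lift_eq hE hΦE
    have hgf : g.1 ⊆ f.1 := by
      rw [← Q.lift_subset_lift, hg, hf]
      exact convexHull_min hAF (hF.1.convex h.polytope.convex)
    have hH := Q.isFullPolytope.isFace_sewn_of_isBeneath g.2 hff hgf
      (h.beyond_quotient.isBeneath hff hfl hpar)
    have hwg : w ∉ g.1 := fun hw => h.notMem_carrier (g.2.subset hw)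
    have hr : Face.restrict ⟨_, hH⟩ = g := Subtype.ext (inter_eq_left.2 g.2.subset)
    refine ⟨⟨_, hH⟩, ?_⟩
    ext v
    refine and_congr_right fun hv => ?_
    rw [hr, hg, h.mem_of_mem_convexHull hAV hv, h.mem_baseFace_iff hi him hv]
    have h1 := hyi v
    have h2 : v = y i → v ∉ K := by
      rintro rfl
      exact hyK
    simp only [hA, mem_ofPred_eq, hv, true_and]
    tauto

/-- The isomorphism between the face lattice of the polytope sewn onto the quotient and an
interval of the face lattice of the sewn polytope. -/
theorem exists_orderIso (h : QuotientSewing m i e P x y z hG Q w)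
    (hG' : IsFace (sewn P z) (convexHull ℝ (insert z (baseFace x y i)))) :
    ∃ Θ : Face (sewn Q.carrier w) ≃o Ici (⟨_, hG'⟩ : Face (sewn P z)),
      ∀ H, sewnCode P x y i (Θ H).1.1 = quotientCode x y Q i w H := by
  refine exists_orderIso_of_forall (quotientCode x y Q i w)
    (fun K : Ici (⟨_, hG'⟩ : Face (sewn P z)) => sewnCode P x y i K.1.1) h.quotientCode_le_iff
    (fun K K' => h.sewnCode_le_iff K.1.2 K'.1.2 K'.2) (fun H => ?_) fun K =>
      h.exists_quotientCode_eq K.1.2 K.2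
  obtain ⟨K, hK, hb, heq⟩ := h.exists_sewnCode_eq H
  exact ⟨⟨⟨K, hK⟩, hb⟩, heq⟩

end QuotientSewing

end Sewing

/-! ### The correspondence of vertices. -/

namespace Sewing
open Set SewingData

variable {m i e : ℕ} {P : Set (Euc (2 * m))} {x y : ℕ → Euc (2 * m)} {z : Euc (2 * m)}

theorem QuotientPolytope.IsStarVertex.unique {d : ℕ} {R : Set (Euc d)} {G : Face R}
    {Q : QuotientPolytope R G e} {v : Euc d} {p q : Euc e} (hp : Q.IsStarVertex v p)
    (hq : Q.IsStarVertex v q) : p = q := by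
  obtain ⟨f, hf, hfl⟩ := hp
  obtain ⟨g, hg, hgl⟩ := hq
  have h1 : f = g := Q.faceIso.injective (Subtype.ext (hfl.unique hgl))
  rw [h1, hg] at hf
  exact (singleton_injective hf).symm

/-- In a single point, every vertex outside the face corresponds to that point. -/
theorem QuotientPolytope.isStarVertex_of_subsingleton {d : ℕ} [Subsingleton (Euc e)]
    {R : Set (Euc d)} {G : Face R} (Q : QuotientPolytope R G e) {v : Euc d} (hv : v ∈ R)
    (hvG : v ∉ G.1) (p : Euc e) : Q.IsStarVertex v p := by
  rw [Q.isStarVertex_iff]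
  refine ⟨⟨Q.carrier, IsExposed.refl _⟩, ?_, by rwa [Q.lift_self], fun E hE hGE hvE => ?_⟩
  · change Q.carrier = {p}
    rw [Subsingleton.eq_univ_of_nonempty Q.isFullPolytope.nonempty,
      Subsingleton.eq_univ_of_nonempty (singleton_nonempty p)]
  · obtain ⟨g, rfl⟩ := Q.exists_lift_eq hE hGE
    rw [Q.lift_subset_lift]
    rcases g.1.eq_empty_or_nonempty with h | h
    · have hg : g = ⟨∅, isExposed_empty⟩ := Subtype.ext h
      rw [hg, Q.lift_empty] at hvE
      exact absurd hvE hvG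
    · rw [Subsingleton.eq_univ_of_nonempty h]
      exact subset_univ _

namespace QuotientSewing

variable {hG : IsFace P (towerFace x y i)} {Q : QuotientPolytope P ⟨_, hG⟩ e} {w : Euc e}

theorem isFace_singleton (h : QuotientSewing m i e P x y z hG Q w) :
    ∃ hw : IsFace (sewn Q.carrier w) {w}, quotientCode x y Q i w ⟨{w}, hw⟩ = {y i} := by
  obtain ⟨⟨F, hF, hb⟩, F', hF', hb'⟩ := h.exists_beyond_beneath
  have hw := (Q.isFullPolytope.isFace_sewn_of_isBeyond_of_isBeneath isExposed_empty hF hF'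
    (empty_subset _) (empty_subset _) hb hb').1
  rw [insert_empty_eq, convexHull_singleton] at hw
  refine ⟨hw, ?_⟩
  have hr : Q.lift (Face.restrict ⟨{w}, hw⟩) = towerFace x y i :=
    lift_restrict_of_eq_empty (singleton_inter_eq_empty.2 h.notMem_carrier)
  ext v
  simp only [quotientCode, hr, mem_ofPred_eq, mem_singleton_iff, and_true]
  constructor
  · rintro ⟨-, h' | h'⟩
    · exact absurd h'.2 h'.1
    · exact h'
  · rintro rfl
    exact ⟨h.y_mem_vertices, Or.inr rfl⟩

/-- Below the last member of the tower, every vertex outside `Φ_i` corresponds to a vertex of the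
quotient, and that vertex survives the sewing. -/
theorem exists_isStarVertex (h : QuotientSewing m i e P x y z hG Q w) {v : Euc (2 * m)}
    (hv : v ∈ vertices P) (hvi : v ∉ towerFace x y i) :
    ∃ p ∈ Q.carrier, Q.IsStarVertex v p ∧ ∃ hp : IsFace (sewn Q.carrier w) {p},
      quotientCode x y Q i w ⟨{p}, hp⟩ = {v} := by
  have hi := h.one_le
  have him := h.lt
  set E : Set (Euc (2 * m)) := convexHull ℝ ({v} ∪ towerFace x y i) with hEdef
  -- Universality of `Φ_i` allows up to `m - i` extra vertices, and `i < m` leaves room for one.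
  have hE : IsFace P E := by
    have := (h.tower.universal i ⟨hi, him.le⟩).2.2.2 {v} (by simpa using hv)
      (by rw [Finset.card_singleton]; omega)
    rwa [Finset.coe_singleton] at this
  have hΦE : towerFace x y i ⊆ E := subset_union_right.trans (subset_convexHull ℝ _)
  have hvE : v ∈ E := subset_convexHull ℝ _ (Or.inl rfl)
  have hmemE : ∀ u ∈ vertices P, u ∈ E → u = v ∨ u ∈ towerFace x y i := fun u hu huE =>
    h.polytope.mem_of_mem_convexHull h.two_mul_pos
      (union_subset (singleton_subset_iff.2 (vertices_subset hv)) hG.subset) hu huE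
  have hEmin : ∀ E', IsFace P E' → towerFace x y i ⊆ E' → v ∈ E' → E ⊆ E' :=
    fun E' hE' h1 h2 => convexHull_min (union_subset (singleton_subset_iff.2 h2) h1)
      (hE'.convex h.polytope.convex)
  have hi1 : i + 1 ∈ Icc 1 m := ⟨by omega, him⟩
  -- `E` has just one vertex outside `Φ_i`, so it misses `x (i + 1)` or `y (i + 1)`. Thus `E` lies
  -- in a facet of level exactly `i`, whose image has quotient level `0`; hence `w` is beneath it
  -- and the vertex survives.
  obtain ⟨u, huP, hu, huE⟩ : ∃ u ∈ P, u ∈ towerFace x y (i + 1) ∧ u ∉ E := by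
    by_cases hvx : x (i + 1) = v
    · refine ⟨y (i + 1), vertices_subset (h.tower.y_mem _ hi1), y_mem_towerFace (by omega) le_rfl,
        fun hyE => ?_⟩
      rcases hmemE _ (h.tower.y_mem _ hi1) hyE with h' | h'
      · exact h.tower.x_ne_y _ hi1 _ hi1 (hvx.trans h'.symm)
      · exact h.tower.y_notMem h.polytope (Nat.lt_succ_self i) him h'
    · refine ⟨x (i + 1), vertices_subset (h.tower.x_mem _ hi1), x_mem_towerFace (by omega) le_rfl,
        fun hxE => ?_⟩
      rcases hmemE _ (h.tower.x_mem _ hi1) hxE with h' | h'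
      · exact hvx h'
      · exact h.tower.x_notMem h.polytope (Nat.lt_succ_self i) him h'
  obtain ⟨F, hF, hEF, -, hl⟩ :=
    IsUniversalTower.exists_facet_isLevel h.polytope h.pos hE ⟨v, hvE⟩ him hΦE huP hu huE
  obtain ⟨f, hf⟩ := Q.exists_lift_eq hE hΦE
  obtain ⟨g, hg, hgf, hgl⟩ := h.exists_facet_lift hF (hΦE.trans hEF) hl
  have hfne : f.1.Nonempty := by
    by_contra hemp
    have hf0 : f = ⟨∅, isExposed_empty⟩ := Subtype.ext (not_nonempty_iff_eq_empty.1 hemp)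
    rw [hf0, Q.lift_empty] at hf
    exact hvi ((show E ⊆ towerFace x y i from hf.ge) hvE)
  obtain ⟨p, hp, hpf⟩ := Q.isFullPolytope.exists_vertex_mem h.dim_pos f.2 hfne
  have hlp : Q.lift ⟨{p}, hp⟩ ⊆ E := by
    rw [← hf, Q.lift_subset_lift]
    exact singleton_subset_iff.2 hpf
  -- Without `v` the lift would have only vertices of `Φ_i` and would correspond to the empty face.
  have hvp : v ∈ Q.lift ⟨{p}, hp⟩ := by
    by_contra hvp
    have hsub : Q.lift ⟨{p}, hp⟩ ⊆ Q.lift ⟨∅, isExposed_empty⟩ := by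
      rw [Q.lift_empty, h.polytope.face_subset_iff h.two_mul_pos (Q.isFace_lift _) (convex_towerFace i)]
      intro u hu hup
      rcases hmemE u hu (hlp hup) with rfl | h'
      · exact absurd hup hvp
      · exact h'
    exact (singleton_nonempty p).not_subset_empty (Q.lift_subset_lift.1 hsub)
  have hlpE : Q.lift ⟨{p}, hp⟩ = E :=
    hlp.antisymm (hEmin _ (Q.isFace_lift _) (Q.subset_lift _) hvp)
  have hpg : {p} ⊆ g.1 := by
    rw [← Q.lift_subset_lift (f := ⟨{p}, hp⟩), hlpE, hg]
    exact hEF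
  have hface := Q.isFullPolytope.isFace_sewn_of_isBeneath hp hgf hpg
    (h.beyond_quotient.isBeneath hgf hgl (by simp))
  have hpR : p ∈ Q.carrier := vertices_subset hp
  refine ⟨p, hpR, (Q.isStarVertex_iff).2 ⟨⟨{p}, hp⟩, rfl, hvp, fun E' hE' h1 h2 => ?_⟩, hface, ?_⟩
  · rw [hlpE]
    exact hEmin E' hE' h1 h2
  · have hr : Face.restrict ⟨{p}, hface⟩ = (⟨{p}, hp⟩ : Face Q.carrier) :=
      Subtype.ext (inter_eq_left.2 (singleton_subset_iff.2 hpR))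
    have hwp : w ≠ p := by
      rintro rfl
      exact h.notMem_carrier hpR
    ext u
    simp only [quotientCode, hr, hlpE, mem_ofPred_eq, mem_singleton_iff]
    constructor
    · rintro ⟨hu, h' | h'⟩
      · exact (hmemE u hu h'.2).resolve_right h'.1
      · exact absurd h'.2 hwp
    · rintro rfl
      exact ⟨hv, Or.inl ⟨hvi, hvE⟩⟩

theorem quotientCode_of_isStarVertex (h : QuotientSewing m i e P x y z hG Q w) {v : Euc (2 * m)}
    (hv : v ∈ vertices P) (hvi : v ∉ towerFace x y i) {p : Euc e} (hp : Q.IsStarVertex v p) :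
    p ≠ w ∧ ∃ hp : IsFace (sewn Q.carrier w) {p}, quotientCode x y Q i w ⟨{p}, hp⟩ = {v} := by
  obtain ⟨q, hq, hqv, hface⟩ := h.exists_isStarVertex hv hvi
  obtain rfl := hp.unique hqv
  refine ⟨?_, hface⟩
  rintro rfl
  exact h.notMem_carrier hq

theorem mem_vertices_sewn_iff (h : QuotientSewing m i e P x y z hG Q w) (p : Euc e) :
    p ∈ vertices (sewn Q.carrier w) ↔
      p = w ∨ ∃ v ∈ vertices P \ vertices (towerFace x y i), Q.IsStarVertex v p := by
  rw [h.polytope.vertices_face h.two_mul_pos hG]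
  constructor
  · intro hp
    refine or_iff_not_imp_left.2 fun hpw => ?_
    -- The code is an order embedding, so an empty code would put the face `{p}` below the empty
    -- face. For any `v` in the code, `v*` is a face inside `{p}`, hence `p` itself.
    obtain ⟨v, hv⟩ : (quotientCode x y Q i w ⟨{p}, hp⟩).Nonempty := by
      by_contra hemp
      rw [not_nonempty_iff_eq_empty] at hemp
      have hle := (h.quotientCode_le_iff ⟨{p}, hp⟩ ⟨∅, isExposed_empty⟩).1
        (by rw [hemp]; exact empty_subset _)
      exact (singleton_nonempty p).not_subset_empty hle
    have hvi : v ∉ towerFace x y i := by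
      rcases hv.2 with h' | h'
      · exact h'.1
      · exact absurd h'.2.symm hpw
    obtain ⟨q, -, hqv, hq, hcode⟩ := h.exists_isStarVertex hv.1 hvi
    have hle := (h.quotientCode_le_iff ⟨{q}, hq⟩ ⟨{p}, hp⟩).1
      (by rw [hcode]; exact singleton_subset_iff.2 hv)
    have hqp : q = p := singleton_subset_singleton.1 hle
    exact ⟨v, ⟨hv.1, fun h' => hvi h'.2⟩, hqp ▸ hqv⟩
  · rintro (rfl | ⟨v, hv, hvp⟩)
    · exact h.isFace_singleton.1
    · exact (h.quotientCode_of_isStarVertex hv.1 (fun h' => hv.2 ⟨hv.1, h'⟩) hvp).2.1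

/-- Vertices with the same code correspond to each other. -/
theorem isStarVertex_of_sewnCode (h : QuotientSewing m i e P x y z hG Q w)
    {hG' : IsFace (sewn P z) (convexHull ℝ (insert z (baseFace x y i)))}
    {Q' : QuotientPolytope (sewn P z) ⟨_, hG'⟩ e} {f : Face Q'.carrier} {q : Euc e}
    (hf : f.1 = {q}) {v : Euc (2 * m)} (hcode : sewnCode P x y i (Q'.lift f) = {v}) :
    Q'.IsStarVertex v q := by
  have hv : v ∈ sewnCode P x y i (Q'.lift f) := hcode ▸ mem_singleton v
  refine (Q'.isStarVertex_iff).2 ⟨f, hf, hv.2.1, fun E hE hGE hvE => ?_⟩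
  refine (h.sewnCode_le_iff (Q'.isFace_lift f) hE hGE).1 ?_
  rw [hcode]
  exact singleton_subset_iff.2 ⟨hv.1, hvE, hv.2.2⟩

/-- The isomorphism preserves codes: `v*` has code `{v}` and `w` has code `{y i}`, and in the other
quotient a vertex with code `{v}` is `v**`. -/
theorem exists_isCombinatorialIso_quotient (h : QuotientSewing m i e P x y z hG Q w)
    {hG' : IsFace (sewn P z) (convexHull ℝ (insert z (baseFace x y i)))}
    (Q' : QuotientPolytope (sewn P z) ⟨_, hG'⟩ e) :
    ∃ φ : Euc e → Euc e, IsCombinatorialIso (sewn Q.carrier w) Q'.carrier φ ∧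
      (∀ v ∈ vertices P \ vertices (towerFace x y i),
        ∃ p, Q.IsStarVertex v p ∧ Q'.IsStarVertex v (φ p)) ∧ Q'.IsStarVertex (y i) (φ w) := by
  obtain ⟨Θ, hΘ⟩ := h.exists_orderIso hG'
  obtain ⟨φ, hφ, hφv⟩ := exists_isCombinatorialIso (Q.isFullPolytope.sewn w) Q'.isFullPolytope
    h.dim_pos h.dim_pos (Θ.trans Q'.faceIso.symm)
  have hstar : ∀ (p : Euc e) (hp : IsFace (sewn Q.carrier w) {p}) (v : Euc (2 * m)),
      quotientCode x y Q i w ⟨{p}, hp⟩ = {v} → Q'.IsStarVertex v (φ p) := by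
    intro p hp v hcode
    refine h.isStarVertex_of_sewnCode (hφv p hp) ?_
    unfold QuotientPolytope.lift
    rw [OrderIso.trans_apply, OrderIso.apply_symm_apply, hΘ, hcode]
  refine ⟨φ, hφ, fun v hv => ?_, ?_⟩
  · rw [h.polytope.vertices_face h.two_mul_pos hG] at hv
    obtain ⟨p, -, hpv, hp, hcode⟩ :=
      h.exists_isStarVertex hv.1 fun h' => hv.2 ⟨hv.1, h'⟩
    exact ⟨p, hpv, hstar p hp v hcode⟩
  · obtain ⟨hw, hcode⟩ := h.isFace_singleton
    exact hstar w hw _ hcode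

end QuotientSewing

theorem isCombinatorialIso_id {d : ℕ} (R : Set (Euc d)) : IsCombinatorialIso R R id :=
  ⟨bijOn_id _, OrderIso.refl _, fun F => by simp⟩

end Sewing

/-! ### Assembly of the theorem. -/

theorem theorem3p1 (m : ℕ) (hm : 1 < m) (P : Set (Sewing.Euc (2 * m)))
    (hP : Sewing.IsFullPolytope P) (hN : Sewing.IsNeighbourly P)
    (hcard : 2 * m + 3 ≤ (Sewing.vertices P).ncard)
    (x y : ℕ → Sewing.Euc (2 * m)) (hT : Sewing.IsUniversalTower P m x y)
    (xbar : Sewing.Euc (2 * m))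
    (hx : Sewing.IsExactlyBeyond P m (Sewing.towerFace x y) xbar)
    (i : ℕ) (hi : 1 ≤ i) (him : i ≤ m) :
    ∃ (hΦ : Sewing.IsFace P (Sewing.towerFace x y i))
      (hG : Sewing.IsFace (Sewing.sewn P xbar)
        (convexHull ℝ (Sewing.towerFace x y (i - 1) ∪ {x i, xbar}))),
      ∀ (Q : Sewing.QuotientPolytope P ⟨_, hΦ⟩ (2 * m - 2 * i))
        (Q' : Sewing.QuotientPolytope (Sewing.sewn P xbar) ⟨_, hG⟩ (2 * m - 2 * i))
        (ybar : Sewing.Euc (2 * m - 2 * i)),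
        Sewing.IsExactlyBeyond Q.carrier (m - i)
          (fun j => Q.star (Sewing.towerFace x y (i + j))) ybar →
        ∃ φ : Sewing.Euc (2 * m - 2 * i) → Sewing.Euc (2 * m - 2 * i),
          Sewing.IsCombinatorialIso (Sewing.sewn Q.carrier ybar) Q'.carrier φ ∧
          -- the vertices of the polytope sewn onto `Q` are the old ones `v*` and `ybar`
          (∀ p, p ∈ Sewing.vertices (Sewing.sewn Q.carrier ybar) ↔ p = ybar ∨
            ∃ v ∈ Sewing.vertices P \ Sewing.vertices (Sewing.towerFace x y i),
              Q.IsStarVertex v p) ∧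
          -- below the top level they are pairwise distinct
          (i < m → ∀ v ∈ Sewing.vertices P \ Sewing.vertices (Sewing.towerFace x y i),
            ∀ p, Q.IsStarVertex v p → p ≠ ybar ∧
              ∀ w ∈ Sewing.vertices P \ Sewing.vertices (Sewing.towerFace x y i),
                Q.IsStarVertex w p → w = v) ∧
          -- every old `v*` exists and is sent to `v**`
          (∀ v ∈ Sewing.vertices P \ Sewing.vertices (Sewing.towerFace x y i),
            ∃ p, Q.IsStarVertex v p ∧ Q'.IsStarVertex v (φ p)) ∧
          -- `ybar` is sent to `y_i**`
          Q'.IsStarVertex (y i) (φ ybar) := by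
  have h : Sewing.SewingData m P x y xbar := ⟨by omega, hP, hN, by omega, hT, hx⟩
  rw [Sewing.convexHull_union_pair_eq]
  obtain ⟨hG', hG'P⟩ := h.isFace_sewn_baseFace hi him
  refine ⟨hT.isFace him, hG', fun Q Q' w hw => ?_⟩
  have hvert : ∀ v, v ∈ Sewing.vertices P \ Sewing.vertices (Sewing.towerFace x y i) ↔
      v ∈ Sewing.vertices P ∧ v ∉ Sewing.towerFace x y i := by
    intro v
    rw [hP.vertices_face h.two_mul_pos (hT.isFace him)]
    exact ⟨fun hv => ⟨hv.1, fun hvi => hv.2 ⟨hv.1, hvi⟩⟩, fun hv => ⟨hv.1, fun hv' => hv.2 hv'.2⟩⟩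
  rcases him.lt_or_eq with hlt | heq
  · have hS : Sewing.QuotientSewing m i (2 * m - 2 * i) P x y xbar (hT.isFace him) Q w :=
      ⟨h, hi, hlt, by omega, hw⟩
    obtain ⟨φ, hφ, hφv, hφw⟩ := hS.exists_isCombinatorialIso_quotient Q'
    refine ⟨φ, hφ, hS.mem_vertices_sewn_iff, fun _ v hv p hp => ?_, hφv, hφw⟩
    rw [hvert] at hv
    obtain ⟨hpw, hpf, hcode⟩ := hS.quotientCode_of_isStarVertex hv.1 hv.2 hp
    refine ⟨hpw, fun u hu hup => ?_⟩
    rw [hvert] at hu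
    obtain ⟨-, _, hcode'⟩ := hS.quotientCode_of_isStarVertex hu.1 hu.2 hup
    exact Set.singleton_injective (hcode'.symm.trans hcode)
  -- For `i = m` the quotients live in dimension zero, where both polytopes are the same single
  -- point and the identity serves as `φ`.
  · have hempty : IsEmpty (Fin (2 * m - 2 * i)) := ⟨fun a => by have := a.2; omega⟩
    have hsub : Subsingleton (Sewing.Euc (2 * m - 2 * i)) :=
      ⟨fun a b => PiLp.ext fun j => hempty.elim j⟩
    have hstar : ∀ v, v ∈ Sewing.vertices P → v ∉ Sewing.baseFace x y i →
        ∀ p, Q'.IsStarVertex v p := fun v hv hvb p =>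
      Q'.isStarVertex_of_subsingleton (Sewing.subset_sewn (Sewing.vertices_subset hv))
        (fun hv' => hvb (hG'P.subset ⟨hv', Sewing.vertices_subset hv⟩)) p
    have hcarrier : Sewing.sewn Q.carrier w = Q'.carrier := by
      rw [Subsingleton.eq_univ_of_nonempty Q'.isFullPolytope.nonempty,
        Subsingleton.eq_univ_of_nonempty ⟨w, Sewing.mem_sewn⟩]
    have hw' : Sewing.sewn Q.carrier w = {w} := by
      rw [Subsingleton.eq_univ_of_nonempty ⟨w, Sewing.mem_sewn⟩,
        Subsingleton.eq_univ_of_nonempty (Set.singleton_nonempty w)]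
    refine ⟨id, ?_, fun p => ?_, fun hlt => absurd heq hlt.ne, fun v hv => ?_, ?_⟩
    · rw [← hcarrier]
      exact Sewing.isCombinatorialIso_id _
    · refine iff_of_true ?_ (Or.inl (Subsingleton.elim p w))
      rw [Subsingleton.elim p w, hw']
      exact IsExposed.refl _
    · rw [hvert] at hv
      exact ⟨w, Q.isStarVertex_of_subsingleton (Sewing.vertices_subset hv.1) hv.2 w,
        hstar v hv.1 (fun hb => hv.2 (Sewing.SewingData.baseFace_subset hi hb)) _⟩
    · exact hstar _ (h.y_mem hi him) (h.y_notMem_baseFace hi him) _
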